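/- Let $m\ge 0$ and consider the exterior Schwarzschild spacetime $\{(t,\mathbf x)\in\mathbb R\times\mathbb R^3:\ r=|\mathbf x|>2m\}$ with metric $g=-h\,dt^2+h^{-1}dr^2+r^2\sigma$, where $h=1-\frac{2m}{r}$ and $\sigma$ is the standard metric of $\mathbb S^2$ (for $m=0$ this is Minkowski spacetime). Let $r_*=r+2m\log\left|\frac{r}{2m}-1\right|$ ($r_*=r$ if $m=0$), $s=r^{-1}$ and $\bar v=t-r_*$. Then $\bar g=s^2g=-s^2(1-2ms)\,d\bar v^2+2\,d\bar v\,ds+\sigma$ extends smoothly to future null infinity $\{s=0\}$. Let $s_0>0$ with $2ms_0\le 1$. Let $\Sigma$ be a spacelike hypersurface which is a graph $t=u(\mathbf x)$ over $\{|\mathbf x|>s_0^{-1}\}$, and put $P(\mathbf y,s)=r_*-u(\mathbf x)$ with $r=s^{-1}$ and $\mathbf x=s^{-1}\mathbf y$, for $\mathbf y\in\mathbb S^2$ and $0<s<s_0$. Thus $\Sigma$ is the zero set of $F=\bar v+P(\mathbf y,s)$. Let $H(\mathbf y,s)$ be the mean curvature of $\Sigma$ in $g$ (one third of the divergence of the unit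 normal) with respect to the future directed unit normal. Let $$L=-\langle\nabla F,\nabla F\rangle_{\bar g}=-\left(2P_s+s^2(1-2ms)P_s^2+|\widetilde\nabla P|^2\right),$$ where $\widetilde\nabla$ is the gradient on $(\mathbb S^2,\sigma)$. Suppose that $P$ and $H$ extend to smooth functions on $\mathbb S^2\times[0,s_0)$ and that $H>0$ on $\mathbb S^2\times[0,s_0)$. Write $H_0=H|_{s=0}$. Then $L=H_0^{-2}$ at every point of $\mathbb S^2\times\{0\}$; that is, $-2P_s-|\widetilde\nabla P|^2=H_0^{-2}$ at $s=0$. -/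

import Mathlib

open scoped Manifold ContDiff Matrix

noncomputable section

namespace Schwarzschild

/-! Semi-Riemannian geometry in the global coordinates of an open subset of `ℝ⁴`, for a metric
given by its matrix field `g`. -/

/-- The partial derivative `∂_a f` at `p`. -/
def pderiv (a : Fin 4) (f : (Fin 4 → ℝ) → ℝ) (p : Fin 4 → ℝ) : ℝ :=
  fderiv ℝ f p (Pi.single a 1)

/-- The Christoffel symbol `Γ^c_{ab}` of the Levi-Civita connection of `g` at `p`. -/
def christoffel (g : (Fin 4 → ℝ) → Matrix (Fin 4) (Fin 4) ℝ) (c a b : Fin 4)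
    (p : Fin 4 → ℝ) : ℝ :=
  (1 / 2) * ∑ d, (g p)⁻¹ c d *
    (pderiv a (fun q => g q b d) p + pderiv b (fun q => g q a d) p
      - pderiv d (fun q => g q a b) p)

/-- The divergence `∇_a X^a = ∂_a X^a + Γ^a_{ab} X^b` of a vector field `X`. -/
def divergence (g : (Fin 4 → ℝ) → Matrix (Fin 4) (Fin 4) ℝ)
    (X : (Fin 4 → ℝ) → (Fin 4 → ℝ)) (p : Fin 4 → ℝ) : ℝ :=
  ∑ a, (pderiv a (fun q => X q a) p + ∑ b, christoffel g a a b p * X p b)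

/-- The gradient `(∇F)^a = g^{ab} ∂_b F`. -/
def grad (g : (Fin 4 → ℝ) → Matrix (Fin 4) (Fin 4) ℝ) (F : (Fin 4 → ℝ) → ℝ)
    (p : Fin 4 → ℝ) : Fin 4 → ℝ :=
  (g p)⁻¹ *ᵥ fun b => pderiv b F p

/-- The unit normal `(-⟨∇F, ∇F⟩)^{-1/2} ∇F` of the level sets of a function `F` with timelike
gradient. -/
def unitNormal (g : (Fin 4 → ℝ) → Matrix (Fin 4) (Fin 4) ℝ) (F : (Fin 4 → ℝ) → ℝ)
    (p : Fin 4 → ℝ) : Fin 4 → ℝ :=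
  (√(-(grad g F p ⬝ᵥ (g p *ᵥ grad g F p))))⁻¹ • grad g F p

/-- The mean curvature of the level set of `F` through `p`, with respect to the unit normal
in the direction of `∇F`: one third of the divergence of the unit normal (equivalently,
one third of the trace of the second fundamental form). -/
def levelSetMeanCurvature (g : (Fin 4 → ℝ) → Matrix (Fin 4) (Fin 4) ℝ)
    (F : (Fin 4 → ℝ) → ℝ) (p : Fin 4 → ℝ) : ℝ :=
  (1 / 3) * divergence g (unitNormal g F) p

/-- The level set of `F` through `p` is spacelike at `p`: the metric is positive definite on its
tangent space `ker dF`. -/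
def IsSpacelikeAt (g : (Fin 4 → ℝ) → Matrix (Fin 4) (Fin 4) ℝ) (F : (Fin 4 → ℝ) → ℝ)
    (p : Fin 4 → ℝ) : Prop :=
  ∀ X : Fin 4 → ℝ, X ≠ 0 → fderiv ℝ F p X = 0 → 0 < X ⬝ᵥ (g p *ᵥ X)

/-! The Schwarzschild spacetime, with coordinates `(t, 𝐱) = (x⁰, x¹, x², x³)` and `|𝐱| > 2m`. -/

/-- Euclidean three-space. -/
abbrev E3 : Type := EuclideanSpace ℝ (Fin 3)

/-- The unit sphere `𝕊²` in `ℝ³`. -/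
abbrev S2 : Type := Metric.sphere (0 : E3) 1

instance finrank_E3 : Fact (Module.finrank ℝ E3 = 2 + 1) := ⟨by simp⟩

/-- The spatial part `𝐱` of the event `(t, 𝐱)`. -/
def spatial (p : Fin 4 → ℝ) : E3 := WithLp.toLp 2 (Fin.tail p)

/-- The event `(t, 𝐱)`. -/
def event (t : ℝ) (x : E3) : Fin 4 → ℝ := Fin.cons t x

/-- The covector `dt`. -/
def dt : Fin 4 → ℝ := Pi.single 0 1

/-- The covector `dr` at `(t, 𝐱)`, with components `(0, 𝐱 / |𝐱|)`. -/
def dr (p : Fin 4 → ℝ) : Fin 4 → ℝ :=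
  Fin.cons 0 fun i => spatial p i / ‖spatial p‖

/-- `h(r) = 1 - 2m/r`. -/
def h (m r : ℝ) : ℝ := 1 - 2 * m / r

/-- The Schwarzschild metric `-h dt² + h⁻¹ dr² + r² σ` in the coordinates `(t, 𝐱)`. The round part
is `r² σ = ∑ᵢ (dxⁱ)² - dr²`, and the identity matrix is `dt² + ∑ᵢ (dxⁱ)²`. -/
def metric (m : ℝ) (p : Fin 4 → ℝ) : Matrix (Fin 4) (Fin 4) ℝ :=
  -h m ‖spatial p‖ • Matrix.vecMulVec dt dt
    + (h m ‖spatial p‖)⁻¹ • Matrix.vecMulVec (dr p) (dr p)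
    + (1 - Matrix.vecMulVec dt dt - Matrix.vecMulVec (dr p) (dr p))

/-- The function `F = u - t`, whose zero set is the graph `t = u(𝐱)`; where the graph is spacelike,
`∇F` is timelike and future directed. -/
def graphFunction (u : E3 → ℝ) (p : Fin 4 → ℝ) : ℝ := u (spatial p) - p 0

/-- The graph `t = u` is spacelike over `x`. -/
def IsSpacelikeGraphAt (m : ℝ) (u : E3 → ℝ) (x : E3) : Prop :=
  IsSpacelikeAt (metric m) (graphFunction u) (event (u x) x)

/-- The mean curvature over `x`, with respect to the future directed unit normal, of the graph
`t = u` in the Schwarzschild spacetime. -/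
def graphMeanCurvature (m : ℝ) (u : E3 → ℝ) (x : E3) : ℝ :=
  levelSetMeanCurvature (metric m) (graphFunction u) (event (u x) x)

/-- `r_* = r + 2m log |r/(2m) - 1|`, which is `r` if `m = 0`. -/
def tortoise (m r : ℝ) : ℝ := r + 2 * m * Real.log |r / (2 * m) - 1|

/-! Null infinity, with coordinates `𝐲 ∈ 𝕊²`, `s = 1/r` and `v̄ = t - r_*`. -/

/-- A function on `𝕊² × ℝ` is smooth on `𝕊² × [0, s₀)`, up to and including `s = 0`. -/
def SmoothUpToNullInfinity (s₀ : ℝ) (f : S2 × ℝ → ℝ) : Prop :=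
  ContMDiffOn ((𝓡 2).prod 𝓘(ℝ, ℝ)) 𝓘(ℝ, ℝ) ∞ f (Set.univ ×ˢ Set.Ico 0 s₀)

/-- The radial projection `x ↦ x / |x|` onto the sphere (with an arbitrary value at `0`). -/
def radialProj (x : E3) : S2 :=
  if hx : x = 0 then ⟨EuclideanSpace.single 0 1, by simp⟩
  else ⟨‖x‖⁻¹ • x, by simp [norm_smul, hx]⟩

/-- The gradient on the round sphere, as a vector of `ℝ³` tangent to the sphere at `y`: the
Euclidean gradient at `y` of the extension of `f` that is constant along rays. -/
def sphereGrad (f : S2 → ℝ) (y : S2) : E3 :=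
  gradient (fun x : E3 => f (radialProj x)) (y : E3)

/-- The squared length `ḡ⁻¹(ω, ω)` of a covector `ω = α + a ds + b dv̄`, with `α` cotangent to
`𝕊²`, for the unphysical metric
`ḡ = s² g = -s² (1 - 2ms) dv̄² + 2 dv̄ ds + σ`, which extends smoothly to `s = 0`; the inverse of
its `(s, v̄)` block has the rows `(s² (1 - 2ms), 1)` and `(1, 0)`. -/
def unphysicalNormSq (m s : ℝ) (α : E3) (a b : ℝ) : ℝ :=
  ‖α‖ ^ 2 + s ^ 2 * (1 - 2 * m * s) * a ^ 2 + 2 * a * b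

/-- `L = -⟨∇F, ∇F⟩_ḡ` for `F = v̄ + P(𝐲, s)`; the derivative in `s` is one-sided at `s = 0`. -/
def nullL (m : ℝ) (P : S2 × ℝ → ℝ) (y : S2) (s : ℝ) : ℝ :=
  -unphysicalNormSq m s (sphereGrad (fun z => P (z, s)) y)
    (derivWithin (fun t => P (y, t)) (Set.Ici 0) s) 1

end Schwarzschild

end

/-!
In Schwarzschild coordinates `(t, 𝐱)` write `r = |𝐱|`, `s = 1/r`, `n = 𝐱/r`, and let
`p(𝐱) = P(n, s)`, so that `u = r_* - p`. As `det g = -1`, the divergence of a vector field is the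
sum of the coordinate derivatives of its components. The gradient of `F = u - t` does not depend on
`t`, its spatial part is `s Y` with `Y = 𝐱 + c`, and `-⟨∇F, ∇F⟩ = s² L`, where `c` and `L` are
smooth up to null infinity. So the unit normal has spatial part `L^{-1/2} Y`, and

`3 H L^{3/2} = (3 + div c) L - ½ dL(Y)`   (`graphMeanCurvature_mul`),

where `div c` and `dL(Y)` are `s` times functions smooth up to null infinity. At `s = 0` this reads
`3 H₀ L^{3/2} = 3 L`, which gives `L = H₀⁻²` wherever `L` does not vanish.

Spacelikeness gives `L > 0` for `s > 0` (`lapseSq_pos_of_isSpacelikeAt`) but only `L ≥ 0` in the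
limit. That `L` stays away from zero follows from a maximum principle (`exists_pos_le_bulkL`): for
large `r` the vector `-Y` points towards smaller `r`, so at a minimum of `L` over an annulus `R ≤ r ≤ R'` that is not on the
inner sphere, `dL(Y) ≤ 0`. There the equation gives `3 H √L ≥ 3 + div c ≥ 2`, a lower bound for `L`
by the bound on `H`, independent of `R'`.

The bounds and limits come from one closure property: the functions `f(𝐱) = Φ(n, s)` with `Φ`
smooth up to `s = 0` form an algebra (`ExtendsToInfinity`) that is stable under `r ∂_v` for constant
vectors `v`, and under `f ↦ r² ∂_r f`.
-/

namespace Schwarzschild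

/-! ### Functions that extend smoothly to null infinity -/

/-- The set `(ℝ³ ∖ {0}) × [0, s₀)`, a neighbourhood of `𝕊² × [0, s₀)` in `ℝ³ × [0, s₀)`. Functions on
`𝕊² × [0, s₀)` are handled as functions on this set, where ordinary calculus is available. -/
def collar (s₀ : ℝ) : Set (E3 × ℝ) := {0}ᶜ ×ˢ Set.Ico 0 s₀

/-- `f(𝐱) = Φ(𝐱 / |𝐱|, 1 / |𝐱|)` on the exterior region `|𝐱| > s₀⁻¹`, with `Φ` smooth up to `s = 0`.
Only the values of `Φ` on `𝕊² × [0, s₀)` matter; in particular, `Φ` is not required to be constant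
along the rays of `ℝ³`. -/
def IsExtension (s₀ : ℝ) (Φ : E3 × ℝ → ℝ) (f : E3 → ℝ) : Prop :=
  ContDiffOn ℝ ∞ Φ (collar s₀) ∧ ∀ x, s₀⁻¹ < ‖x‖ → f x = Φ (‖x‖⁻¹ • x, ‖x‖⁻¹)

/-- The function `f` on the exterior region extends smoothly to null infinity. -/
def ExtendsToInfinity (s₀ : ℝ) (f : E3 → ℝ) : Prop := ∃ Φ, IsExtension s₀ Φ f

theorem uniqueDiffOn_collar (s₀ : ℝ) : UniqueDiffOn ℝ (collar s₀) :=
  isOpen_compl_singleton.uniqueDiffOn.prod (uniqueDiffOn_Ico 0 s₀)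

section Extension

variable {s₀ : ℝ} {f g : E3 → ℝ} {Φ : E3 × ℝ → ℝ}

namespace ExtendsToInfinity

theorem const (a : ℝ) : ExtendsToInfinity s₀ (fun _ => a) :=
  ⟨fun _ => a, contDiffOn_const, fun _ _ => rfl⟩

theorem add (hf : ExtendsToInfinity s₀ f) (hg : ExtendsToInfinity s₀ g) :
    ExtendsToInfinity s₀ (fun x => f x + g x) := by
  obtain ⟨Φ, h1, h2⟩ := hf
  obtain ⟨Ψ, h3, h4⟩ := hg
  exact ⟨fun z => Φ z + Ψ z, h1.add h3, fun x hx => by simp only [h2 x hx, h4 x hx]⟩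

theorem mul (hf : ExtendsToInfinity s₀ f) (hg : ExtendsToInfinity s₀ g) :
    ExtendsToInfinity s₀ (fun x => f x * g x) := by
  obtain ⟨Φ, h1, h2⟩ := hf
  obtain ⟨Ψ, h3, h4⟩ := hg
  exact ⟨fun z => Φ z * Ψ z, h1.mul h3, fun x hx => by simp only [h2 x hx, h4 x hx]⟩

theorem sub (hf : ExtendsToInfinity s₀ f) (hg : ExtendsToInfinity s₀ g) :
    ExtendsToInfinity s₀ (fun x => f x - g x) := by
  obtain ⟨Φ, h1, h2⟩ := hf
  obtain ⟨Ψ, h3, h4⟩ := hg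
  exact ⟨fun z => Φ z - Ψ z, h1.sub h3, fun x hx => by simp only [h2 x hx, h4 x hx]⟩

theorem pow (hf : ExtendsToInfinity s₀ f) (k : ℕ) :
    ExtendsToInfinity s₀ (fun x => f x ^ k) := by
  obtain ⟨Φ, h1, h2⟩ := hf
  exact ⟨fun z => Φ z ^ k, h1.pow k, fun x hx => by simp only [h2 x hx]⟩

theorem sum {F : Fin 3 → E3 → ℝ} (hF : ∀ i, ExtendsToInfinity s₀ (F i)) :
    ExtendsToInfinity s₀ (fun x => ∑ i, F i x) := by
  simp only [Fin.sum_univ_three]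
  exact ((hF 0).add (hF 1)).add (hF 2)

theorem inv_norm : ExtendsToInfinity s₀ (fun x => ‖x‖⁻¹) :=
  ⟨fun z => z.2, contDiffOn_snd, fun _ _ => rfl⟩

theorem coord (i : Fin 3) : ExtendsToInfinity s₀ (fun x => x i / ‖x‖) := by
  refine ⟨fun z => z.1 i, ?_, fun x _ => by simp [div_eq_inv_mul]⟩
  have : ContDiff ℝ ∞ (fun z : E3 × ℝ => EuclideanSpace.proj (𝕜 := ℝ) i z.1) := by fun_prop
  exact this.contDiffOn

end ExtendsToInfinity

theorem hasFDerivAt_norm_E3 {x : E3} (hx : x ≠ 0) :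
    HasFDerivAt (fun x : E3 => ‖x‖) (‖x‖⁻¹ • innerSL ℝ x) x := by
  have h := (hasStrictFDerivAt_norm_sq x).hasFDerivAt.sqrt (by positivity)
  simp only [Real.sqrt_sq (norm_nonneg _)] at h
  refine h.congr_fderiv ?_
  rw [← Nat.cast_smul_eq_nsmul ℝ, smul_smul]
  congr 1
  push_cast
  field_simp

theorem pos_of_exterior (hs₀ : 0 < s₀) {x : E3} (hx : s₀⁻¹ < ‖x‖) : 0 < ‖x‖ :=
  (inv_pos.2 hs₀).trans hx

theorem isOpen_exterior (s₀ : ℝ) : IsOpen {x : E3 | s₀⁻¹ < ‖x‖} :=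
  isOpen_lt continuous_const continuous_norm

theorem mem_collar (hs₀ : 0 < s₀) {x : E3} (hx : s₀⁻¹ < ‖x‖) :
    (‖x‖⁻¹ • x, ‖x‖⁻¹) ∈ {0}ᶜ ×ˢ Set.Ioo (0 : ℝ) s₀ := by
  have h0 := pos_of_exterior hs₀ hx
  refine ⟨?_, inv_pos.2 h0, inv_lt_of_inv_lt₀ hs₀ hx⟩
  simp [norm_pos_iff.1 h0]

theorem interior_subset_collar : ({0}ᶜ ×ˢ Set.Ioo (0 : ℝ) s₀ : Set (E3 × ℝ)) ⊆ collar s₀ :=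
  Set.prod_mono le_rfl Set.Ioo_subset_Ico_self

theorem collar_mem_nhds {z : E3 × ℝ} (hz : z ∈ {0}ᶜ ×ˢ Set.Ioo (0 : ℝ) s₀) :
    collar s₀ ∈ nhds z :=
  Filter.mem_of_superset ((isOpen_compl_singleton.prod isOpen_Ioo).mem_nhds hz)
    interior_subset_collar

namespace IsExtension

theorem congr (hf : IsExtension s₀ Φ f) (h : ∀ x, s₀⁻¹ < ‖x‖ → g x = f x) :
    IsExtension s₀ Φ g :=
  ⟨hf.1, fun x hx => (h x hx).trans (hf.2 x hx)⟩

/-- The chain rule for `f(𝐱) = Φ(𝐱 / |𝐱|, 1 / |𝐱|)`, multiplied by `|𝐱|` so that the right-hand side is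
again a function of `(𝐱 / |𝐱|, 1 / |𝐱|)`. -/
theorem hasFDerivAt (hs₀ : 0 < s₀) (hf : IsExtension s₀ Φ f) {x : E3} (hx : s₀⁻¹ < ‖x‖) :
    DifferentiableAt ℝ f x ∧ ∀ v, ‖x‖ * fderiv ℝ f x v =
      fderivWithin ℝ Φ (collar s₀) (‖x‖⁻¹ • x, ‖x‖⁻¹)
        (v - inner ℝ (‖x‖⁻¹ • x) v • ‖x‖⁻¹ • x, - (‖x‖⁻¹ * inner ℝ (‖x‖⁻¹ • x) v)) := by
  have h0 := pos_of_exterior hs₀ hx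
  have hx0 : x ≠ 0 := norm_pos_iff.1 h0
  have hn := hasFDerivAt_norm_E3 hx0
  have hinv : HasFDerivAt (fun x : E3 => ‖x‖⁻¹) _ x :=
    (hasDerivAt_inv h0.ne').comp_hasFDerivAt x hn
  have hdir := hinv.smul (hasFDerivAt_id x)
  have hz := mem_collar hs₀ hx
  have hΦ : HasFDerivAt Φ (fderivWithin ℝ Φ (collar s₀) (‖x‖⁻¹ • x, ‖x‖⁻¹))
      (‖x‖⁻¹ • x, ‖x‖⁻¹) := by
    rw [fderivWithin_of_mem_nhds (collar_mem_nhds hz)]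
    exact ((hf.1.contDiffAt (collar_mem_nhds hz)).differentiableAt (by simp)).hasFDerivAt
  have hcomp := hΦ.comp x (hdir.prodMk hinv)
  have hfx : HasFDerivAt f _ x := hcomp.congr_of_eventuallyEq (by
    filter_upwards [(isOpen_exterior s₀).mem_nhds hx] with y hy
    exact hf.2 y hy)
  refine ⟨hfx.differentiableAt, fun v => ?_⟩
  rw [hfx.fderiv, ContinuousLinearMap.comp_apply, ← smul_eq_mul, ← map_smul]
  congr 1
  refine Prod.ext ?_ ?_
  · ext i
    simp [real_inner_smul_left]
    field_simp
    ring
  · simp [real_inner_smul_left]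
    field_simp

/-- The radial derivative: `r² ∂_r f = -∂_s Φ`. -/
theorem mul_fderiv_self (hs₀ : 0 < s₀) (hf : IsExtension s₀ Φ f) {x : E3} (hx : s₀⁻¹ < ‖x‖) :
    ‖x‖ * fderiv ℝ f x x =
      - fderivWithin ℝ Φ (collar s₀) (‖x‖⁻¹ • x, ‖x‖⁻¹) (0, 1) := by
  have h0 := pos_of_exterior hs₀ hx
  rw [(hf.hasFDerivAt hs₀ hx).2, ← map_neg]
  congr 1
  refine Prod.ext ?_ ?_
  · ext i
    simp [real_inner_smul_left]
    field_simp
    ring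
  · simp [real_inner_smul_left]
    field_simp

theorem contDiffOn_fderivWithin (hf : IsExtension s₀ Φ f) :
    ContDiffOn ℝ ∞ (fderivWithin ℝ Φ (collar s₀)) (collar s₀) :=
  hf.1.fderivWithin (uniqueDiffOn_collar s₀) (by simp)

theorem angular (hs₀ : 0 < s₀) (hf : IsExtension s₀ Φ f) (v : E3) :
    IsExtension s₀ (fun z => fderivWithin ℝ Φ (collar s₀) z
      (v - inner ℝ z.1 v • z.1, - (z.2 * inner ℝ z.1 v))) (fun x => ‖x‖ * fderiv ℝ f x v) := by
  refine ⟨hf.contDiffOn_fderivWithin.clm_apply ?_, fun x hx => (hf.hasFDerivAt hs₀ hx).2 v⟩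
  have : ContDiff ℝ ∞ (fun z : E3 × ℝ =>
      (v - inner ℝ z.1 v • z.1, - (z.2 * inner ℝ z.1 v))) := by
    have hi : ContDiff ℝ ∞ (fun z : E3 × ℝ => inner ℝ z.1 v) :=
      contDiff_fst.inner ℝ contDiff_const
    exact (contDiff_const.sub (hi.smul contDiff_fst)).prodMk (contDiff_snd.mul hi).neg
  exact this.contDiffOn

theorem radial (hs₀ : 0 < s₀) (hf : IsExtension s₀ Φ f) :
    IsExtension s₀ (fun z => - fderivWithin ℝ Φ (collar s₀) z (0, 1))
      (fun x => ‖x‖ * fderiv ℝ f x x) :=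
  ⟨(hf.contDiffOn_fderivWithin.clm_apply contDiffOn_const).neg,
    fun _ hx => hf.mul_fderiv_self hs₀ hx⟩

/-- The limit along the ray through `y ∈ 𝕊²` is the value at the point `(y, 0)` of null infinity. -/
theorem tendsto (hs₀ : 0 < s₀) (hf : IsExtension s₀ Φ f) {y : E3} (hy : ‖y‖ = 1) :
    Filter.Tendsto (fun l : ℝ => f (l • y)) Filter.atTop (nhds (Φ (y, 0))) := by
  have hy0 : y ≠ 0 := by rintro rfl; simp at hy
  have hc : ContinuousWithinAt Φ (collar s₀) (y, 0) :=
    hf.1.continuousOn _ ⟨hy0, le_rfl, hs₀⟩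
  have ht : Filter.Tendsto (fun l : ℝ => (y, l⁻¹)) Filter.atTop
      (nhdsWithin (y, 0) (collar s₀)) := by
    refine tendsto_nhdsWithin_iff.2 ⟨tendsto_const_nhds.prodMk_nhds tendsto_inv_atTop_zero, ?_⟩
    filter_upwards [Filter.eventually_gt_atTop s₀⁻¹] with l hl
    have hl0 : 0 < l := (inv_pos.2 hs₀).trans hl
    exact ⟨hy0, (inv_pos.2 hl0).le, inv_lt_of_inv_lt₀ hs₀ hl⟩
  refine (hc.tendsto.comp ht).congr' ?_
  filter_upwards [Filter.eventually_gt_atTop s₀⁻¹] with l hl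
  have hl0 : 0 < l := (inv_pos.2 hs₀).trans hl
  have hn : ‖l • y‖ = l := by rw [norm_smul, hy, Real.norm_of_nonneg hl0.le, mul_one]
  rw [hf.2 _ (by rwa [hn]), hn, smul_smul, inv_mul_cancel₀ hl0.ne', one_smul]
  rfl

end IsExtension

namespace ExtendsToInfinity

theorem differentiableAt (hs₀ : 0 < s₀) (hf : ExtendsToInfinity s₀ f) {x : E3}
    (hx : s₀⁻¹ < ‖x‖) : DifferentiableAt ℝ f x := by
  obtain ⟨Φ, hΦ⟩ := hf
  exact (hΦ.hasFDerivAt hs₀ hx).1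

theorem angular (hs₀ : 0 < s₀) (hf : ExtendsToInfinity s₀ f) (v : E3) :
    ExtendsToInfinity s₀ (fun x => ‖x‖ * fderiv ℝ f x v) := by
  obtain ⟨Φ, hΦ⟩ := hf
  exact ⟨_, hΦ.angular hs₀ v⟩

theorem radial (hs₀ : 0 < s₀) (hf : ExtendsToInfinity s₀ f) :
    ExtendsToInfinity s₀ (fun x => ‖x‖ * fderiv ℝ f x x) := by
  obtain ⟨Φ, hΦ⟩ := hf
  exact ⟨_, hΦ.radial hs₀⟩

/-- Boundedness near infinity, from compactness of `𝕊² × [0, R⁻¹]`. -/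
theorem bounded (hs₀ : 0 < s₀) (hf : ExtendsToInfinity s₀ f) {R : ℝ} (hR : s₀⁻¹ < R) :
    ∃ C, ∀ x, R ≤ ‖x‖ → |f x| ≤ C := by
  obtain ⟨Φ, h1, h2⟩ := hf
  have hR0 : 0 < R := (inv_pos.2 hs₀).trans hR
  have hK : IsCompact (Metric.sphere (0 : E3) 1 ×ˢ Set.Icc (0 : ℝ) R⁻¹) :=
    (isCompact_sphere _ _).prod isCompact_Icc
  have hsub : Metric.sphere (0 : E3) 1 ×ˢ Set.Icc (0 : ℝ) R⁻¹ ⊆ collar s₀ := by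
    refine Set.prod_mono (fun y hy => ?_) (Set.Icc_subset_Ico_right (inv_lt_of_inv_lt₀ hs₀ hR))
    rintro rfl
    simp at hy
  obtain ⟨C, hC⟩ := hK.exists_bound_of_continuousOn (h1.continuousOn.mono hsub)
  refine ⟨C, fun x hx => ?_⟩
  have h0 : 0 < ‖x‖ := hR0.trans_le hx
  rw [h2 x (hR.trans_le hx)]
  refine hC _ ⟨?_, (inv_pos.2 h0).le, inv_anti₀ hR0 hx⟩
  simp [norm_smul, h0.ne']

end ExtendsToInfinity

end Extension

/-! ### The radial projection -/

theorem contMDiffAt_radialProj {x : E3} (hx : x ≠ 0) :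
    ContMDiffAt 𝓘(ℝ, E3) (𝓡 2) ∞ radialProj x := by
  let U : TopologicalSpace.Opens E3 := ⟨{0}ᶜ, isOpen_compl_singleton⟩
  have hval : ContMDiff 𝓘(ℝ, E3) 𝓘(ℝ, E3) ∞ (fun z : U => ‖(z : E3)‖⁻¹ • (z : E3)) := by
    intro z
    refine contMDiffAt_subtype_iff (f := fun z : E3 => ‖z‖⁻¹ • z) |>.2 ?_
    have hz : (z : E3) ≠ 0 := z.2
    exact (((contDiffAt_norm ℝ hz).inv (norm_ne_zero_iff.2 hz)).smul contDiffAt_id).contMDiffAt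
  have hs : ContMDiff 𝓘(ℝ, E3) (𝓡 2) ∞ (fun z : U => radialProj z) := by
    have hmem : ∀ z : U, ‖(z : E3)‖⁻¹ • (z : E3) ∈ Metric.sphere (0 : E3) 1 := fun z => by
      have hz : (z : E3) ≠ 0 := z.2
      simp [norm_smul, hz]
    refine (hval.codRestrict_sphere (n := 2) hmem).congr fun z => ?_
    have hz : (z : E3) ≠ 0 := z.2
    ext1
    simp [radialProj, hz]
  exact contMDiffAt_subtype_iff (x := (⟨x, hx⟩ : U)).1 (hs _)

theorem contDiffOn_comp_radialProj {s₀ : ℝ} {P : S2 × ℝ → ℝ} (hP : SmoothUpToNullInfinity s₀ P) :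
    ContDiffOn ℝ ∞ (fun z : E3 × ℝ => P (radialProj z.1, z.2)) (collar s₀) := by
  rw [← contMDiffOn_iff_contDiffOn]
  refine hP.comp (t := Set.univ ×ˢ Set.Ico 0 s₀) (s := collar s₀)
    (f := fun z : E3 × ℝ => (radialProj z.1, z.2)) ?_ (fun z hz => ⟨trivial, hz.2⟩)
  intro z hz
  rw [modelWithCornersSelf_prod, ← chartedSpaceSelf_prod]
  exact (((contMDiffAt_radialProj hz.1).comp z contMDiffAt_fst).prodMk
    contMDiffAt_snd).contMDiffWithinAt

theorem radialProj_smul (y : S2) {l : ℝ} (hl : 0 < l) : radialProj (l • (y : E3)) = y := by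
  have hy : ‖(y : E3)‖ = 1 := by simp
  have hy0 : (y : E3) ≠ 0 := by intro h; simp [h] at hy
  ext1
  rw [radialProj, dif_neg (smul_ne_zero hl.ne' hy0)]
  simp only [norm_smul, hy, Real.norm_of_nonneg hl.le, mul_one, smul_smul,
    inv_mul_cancel₀ hl.ne', one_smul]

theorem radialProj_smul_of_ne {x : E3} (hx : x ≠ 0) {l : ℝ} (hl : 0 < l) :
    radialProj (l • x) = radialProj x := by
  ext1
  rw [radialProj, radialProj, dif_neg (smul_ne_zero hl.ne' hx), dif_neg hx]
  simp only [norm_smul, Real.norm_of_nonneg hl.le, smul_smul]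
  congr 1
  field_simp

theorem smul_radialProj {x : E3} (hx : x ≠ 0) : ‖x‖ • (radialProj x : E3) = x := by
  rw [radialProj, dif_neg hx]
  simp [smul_smul, hx]

/-- A function smooth on `𝕊² × [0, s₀)`, extended to be constant along the rays of `ℝ³`, is smooth on
the collar. -/
theorem SmoothUpToNullInfinity.isExtension {s₀ : ℝ} (hs₀ : 0 < s₀) {P : S2 × ℝ → ℝ}
    (hP : SmoothUpToNullInfinity s₀ P) :
    IsExtension s₀ (fun z : E3 × ℝ => P (radialProj z.1, z.2))
      (fun x => P (radialProj x, ‖x‖⁻¹)) := by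
  refine ⟨contDiffOn_comp_radialProj hP, fun x hx => ?_⟩
  have h0 := pos_of_exterior hs₀ hx
  simp only [radialProj_smul_of_ne (norm_pos_iff.1 h0) (inv_pos.2 h0)]

/-! ### The inverse metric and the volume form -/

theorem norm_sq_spatial (p : Fin 4 → ℝ) :
    ‖spatial p‖ ^ 2 = spatial p 0 ^ 2 + spatial p 1 ^ 2 + spatial p 2 ^ 2 := by
  rw [EuclideanSpace.norm_sq_eq, Fin.sum_univ_three]
  simp

theorem dt_dotProduct_dt : dt ⬝ᵥ dt = 1 := by simp [dt]

theorem dt_dotProduct_dr (p : Fin 4 → ℝ) : dt ⬝ᵥ dr p = 0 := by simp [dt, dr]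

theorem dr_dotProduct_dr {p : Fin 4 → ℝ} (hp : 0 < ‖spatial p‖) : dr p ⬝ᵥ dr p = 1 := by
  have := norm_sq_spatial p
  simp only [dr, dotProduct, Fin.sum_univ_succ (n := 3), Fin.cons_zero, Fin.cons_succ,
    Fin.sum_univ_three]
  field_simp
  linarith

/-- The inverse metric `-h⁻¹ ∂_t² + h ∂_r² + r⁻² σ⁻¹`, as a matrix in the coordinates `(t, 𝐱)`. -/
noncomputable def invMetric (m : ℝ) (p : Fin 4 → ℝ) : Matrix (Fin 4) (Fin 4) ℝ :=
  -(h m ‖spatial p‖)⁻¹ • Matrix.vecMulVec dt dt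
    + h m ‖spatial p‖ • Matrix.vecMulVec (dr p) (dr p)
    + (1 - Matrix.vecMulVec dt dt - Matrix.vecMulVec (dr p) (dr p))

theorem metric_inv {m : ℝ} {p : Fin 4 → ℝ} (hp : 0 < ‖spatial p‖) (hh : h m ‖spatial p‖ ≠ 0) :
    (metric m p)⁻¹ = invMetric m p := by
  apply Matrix.inv_eq_right_inv
  rw [metric, invMetric]
  have hA : Matrix.vecMulVec dt dt * Matrix.vecMulVec dt dt = Matrix.vecMulVec dt dt := by
    rw [Matrix.vecMulVec_mul_vecMulVec, dt_dotProduct_dt, one_smul]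
  have hB : Matrix.vecMulVec (dr p) (dr p) * Matrix.vecMulVec (dr p) (dr p)
      = Matrix.vecMulVec (dr p) (dr p) := by
    rw [Matrix.vecMulVec_mul_vecMulVec, dr_dotProduct_dr hp, one_smul]
  have hAB : Matrix.vecMulVec dt dt * Matrix.vecMulVec (dr p) (dr p) = 0 := by
    rw [Matrix.vecMulVec_mul_vecMulVec, dt_dotProduct_dr, zero_smul, Matrix.vecMulVec_zero]
  have hBA : Matrix.vecMulVec (dr p) (dr p) * Matrix.vecMulVec dt dt = 0 := by
    rw [Matrix.vecMulVec_mul_vecMulVec, dotProduct_comm, dt_dotProduct_dr, zero_smul,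
      Matrix.vecMulVec_zero]
  generalize Matrix.vecMulVec dt dt = A at *
  generalize Matrix.vecMulVec (dr p) (dr p) = B at *
  generalize h m ‖spatial p‖ = k at *
  simp only [add_mul, mul_add, sub_mul, mul_sub, smul_mul_assoc, mul_smul_comm, hA, hB, hAB, hBA,
    one_mul, mul_one, smul_smul, smul_zero, neg_smul, smul_add, smul_sub, smul_neg, neg_mul, mul_neg,
    mul_inv_cancel₀ hh, inv_mul_cancel₀ hh]
  simp only [one_smul]
  abel

theorem metric_symm (m : ℝ) (p : Fin 4 → ℝ) (a b : Fin 4) : metric m p a b = metric m p b a := by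
  simp only [metric, Matrix.add_apply, Matrix.sub_apply, Matrix.smul_apply, Matrix.vecMulVec_apply,
    smul_eq_mul, Matrix.one_apply, eq_comm (a := a)]
  ring

theorem invMetric_symm (m : ℝ) (p : Fin 4 → ℝ) (a b : Fin 4) :
    invMetric m p a b = invMetric m p b a := by
  simp only [invMetric, Matrix.add_apply, Matrix.sub_apply, Matrix.smul_apply,
    Matrix.vecMulVec_apply, smul_eq_mul, Matrix.one_apply, eq_comm (a := a)]
  ring

/-- `Γ^a_{ab} = ½ g^{ad} ∂_b g_{ad}`: the other two terms of the Christoffel symbol cancel by symmetry. -/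
theorem sum_christoffel {m : ℝ} {p : Fin 4 → ℝ} (hp : 0 < ‖spatial p‖)
    (hh : h m ‖spatial p‖ ≠ 0) (b : Fin 4) :
    ∑ a, christoffel (metric m) a a b p = 
      (1 / 2) * ∑ a, ∑ d, invMetric m p a d * pderiv b (fun q => metric m q a d) p := by
  simp only [christoffel, metric_inv hp hh, ← Finset.mul_sum]
  congr 1
  simp only [mul_sub, mul_add, Finset.sum_sub_distrib, Finset.sum_add_distrib]
  rw [add_comm, add_sub_assoc, add_eq_left, sub_eq_zero, Finset.sum_comm]
  refine Finset.sum_congr rfl fun a _ => Finset.sum_congr rfl fun d _ => ?_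
  rw [invMetric_symm]
  simp only [metric_symm m _ b]

/-- The projection `(t, 𝐱) ↦ 𝐱` as a continuous linear map. -/
noncomputable def spatialL : (Fin 4 → ℝ) →L[ℝ] E3 :=
  (EuclideanSpace.equiv (Fin 3) ℝ).symm.toContinuousLinearMap ∘L
    ContinuousLinearMap.pi fun i => ContinuousLinearMap.proj i.succ

theorem hasFDerivAt_spatial (p : Fin 4 → ℝ) : HasFDerivAt spatial spatialL p :=
  spatialL.hasFDerivAt (x := p)

theorem spatialL_single_zero : spatialL (Pi.single 0 1) = 0 := by
  ext i
  simp [spatialL]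

theorem spatialL_single_succ (i : Fin 3) :
    spatialL (Pi.single i.succ 1) = EuclideanSpace.single i 1 := by
  ext j
  simp [spatialL, Pi.single_apply]

theorem pderiv_zero_comp_spatial {f : E3 → ℝ} {p : Fin 4 → ℝ}
    (hf : DifferentiableAt ℝ f (spatial p)) : pderiv 0 (fun q => f (spatial q)) p = 0 := by
  have hc : HasFDerivAt (fun q => f (spatial q)) _ p :=
    hf.hasFDerivAt.comp p (hasFDerivAt_spatial p)
  rw [pderiv, hc.fderiv, ContinuousLinearMap.comp_apply, spatialL_single_zero, map_zero]

theorem pderiv_succ_comp_spatial {f : E3 → ℝ} {p : Fin 4 → ℝ}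
    (hf : DifferentiableAt ℝ f (spatial p)) (i : Fin 3) :
    pderiv i.succ (fun q => f (spatial q)) p =
      fderiv ℝ f (spatial p) (EuclideanSpace.single i 1) := by
  have hc : HasFDerivAt (fun q => f (spatial q)) _ p :=
    hf.hasFDerivAt.comp p (hasFDerivAt_spatial p)
  rw [pderiv, hc.fderiv, ContinuousLinearMap.comp_apply, spatialL_single_succ]

theorem invMetric_mulVec (m : ℝ) (p w : Fin 4 → ℝ) :
    invMetric m p *ᵥ w = (-(h m ‖spatial p‖)⁻¹ * (dt ⬝ᵥ w)) • dt
      + (h m ‖spatial p‖ * (dr p ⬝ᵥ w)) • dr p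
      + (w - (dt ⬝ᵥ w) • dt - (dr p ⬝ᵥ w) • dr p) := by
  simp only [invMetric, Matrix.add_mulVec, Matrix.sub_mulVec, Matrix.smul_mulVec,
    Matrix.vecMulVec_mulVec, Matrix.one_mulVec, op_smul_eq_smul, smul_smul]

theorem invMetric_mulVec_dt (m : ℝ) (p : Fin 4 → ℝ) :
    invMetric m p *ᵥ dt = -(h m ‖spatial p‖)⁻¹ • dt := by
  rw [invMetric_mulVec, dt_dotProduct_dt, dotProduct_comm, dt_dotProduct_dr]
  simp

theorem invMetric_mulVec_dr (m : ℝ) {p : Fin 4 → ℝ} (hp : 0 < ‖spatial p‖) :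
    invMetric m p *ᵥ dr p = h m ‖spatial p‖ • dr p := by
  rw [invMetric_mulVec, dr_dotProduct_dr hp, dt_dotProduct_dr]
  simp

theorem differentiableAt_norm_spatial {p : Fin 4 → ℝ} (hp : 0 < ‖spatial p‖) :
    DifferentiableAt ℝ (fun q => ‖spatial q‖) p :=
  (hasFDerivAt_spatial p).differentiableAt.norm ℝ (norm_pos_iff.1 hp)

theorem differentiableAt_dr {p : Fin 4 → ℝ} (hp : 0 < ‖spatial p‖) (a : Fin 4) :
    DifferentiableAt ℝ (fun q => dr q a) p := by
  refine Fin.cases ?_ (fun i => ?_) a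
  · simp only [dr, Fin.cons_zero]
    exact differentiableAt_const _
  · simp only [dr, Fin.cons_succ]
    have hn := differentiableAt_norm_spatial hp
    simp only [div_eq_mul_inv]
    refine DifferentiableAt.mul ?_ (hn.inv hp.ne')
    exact (ContinuousLinearMap.proj (R := ℝ) (φ := fun _ : Fin 4 => ℝ) i.succ).differentiableAt

theorem isOpen_norm_spatial_pos : IsOpen {q : Fin 4 → ℝ | 0 < ‖spatial q‖} :=
  isOpen_lt continuous_const
    (continuous_iff_continuousAt.2 fun p => (hasFDerivAt_spatial p).continuousAt).norm

theorem differentiableAt_h {m : ℝ} {p : Fin 4 → ℝ} (hp : 0 < ‖spatial p‖) :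
    DifferentiableAt ℝ (fun q => h m ‖spatial q‖) p := by
  simp only [h, div_eq_mul_inv]
  exact (((differentiableAt_norm_spatial hp).inv hp.ne').const_mul (2 * m)).const_sub 1

/-- The derivative of the unit covector `dr` is orthogonal to it. -/
theorem dr_dotProduct_pderiv_dr {p : Fin 4 → ℝ} (hp : 0 < ‖spatial p‖) (b : Fin 4) :
    dr p ⬝ᵥ (fun a => pderiv b (fun q => dr q a) p) = 0 := by
  have hd := fun a => (differentiableAt_dr hp a).hasFDerivAt
  have hm : ∀ a, HasFDerivAt (fun q => dr q a * dr q a) (dr p a • fderiv ℝ (fun q => dr q a) p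
      + dr p a • fderiv ℝ (fun q => dr q a) p) p := fun a => (hd a).mul (hd a)
  have h1 := (((hm 0).add (hm 1)).add (hm 2)).add (hm 3)
  have h2 : HasFDerivAt (fun q => dr q 0 * dr q 0 + dr q 1 * dr q 1 + dr q 2 * dr q 2
      + dr q 3 * dr q 3) (0 : (Fin 4 → ℝ) →L[ℝ] ℝ) p := by
    refine (hasFDerivAt_const (1 : ℝ) p).congr_of_eventuallyEq ?_
    filter_upwards [isOpen_norm_spatial_pos.mem_nhds hp] with q hq
    rw [← dr_dotProduct_dr hq, dotProduct, Fin.sum_univ_four]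
  have h3 := congrArg (fun T : (Fin 4 → ℝ) →L[ℝ] ℝ => T (Pi.single b 1)) (h1.unique h2)
  simp only [add_apply, smul_apply, smul_eq_mul,
    zero_apply] at h3
  simp only [dotProduct, pderiv, Fin.sum_univ_four]
  linarith

theorem pderiv_metric {m : ℝ} {p : Fin 4 → ℝ} (hp : 0 < ‖spatial p‖)
    (hh : h m ‖spatial p‖ ≠ 0) (a d b : Fin 4) :
    pderiv b (fun q => metric m q a d) p =
      - pderiv b (fun q => h m ‖spatial q‖) p * (dt a * dt d)
      - pderiv b (fun q => h m ‖spatial q‖) p / h m ‖spatial p‖ ^ 2 * (dr p a * dr p d)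
      + ((h m ‖spatial p‖)⁻¹ - 1) * (pderiv b (fun q => dr q a) p * dr p d
        + dr p a * pderiv b (fun q => dr q d) p) := by
  have hda := (differentiableAt_dr hp a).hasFDerivAt
  have hdd := (differentiableAt_dr hp d).hasFDerivAt
  have hk := (differentiableAt_h (m := m) hp).hasFDerivAt
  have hki := (hasDerivAt_inv hh).comp_hasFDerivAt p hk
  have hM : HasFDerivAt (fun q => metric m q a d) _ p :=
    ((hk.neg.mul_const (dt a * dt d)).add (hki.mul (hda.mul hdd))).add
      ((hasFDerivAt_const ((1 : Matrix (Fin 4) (Fin 4) ℝ) a d - dt a * dt d) p).sub (hda.mul hdd))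
  rw [pderiv, hM.fderiv]
  simp [pderiv]
  ring

/-- `Γ^a_{ab} = 0`, because `det g = -1` is constant. -/
theorem sum_christoffel_eq_zero {m : ℝ} {p : Fin 4 → ℝ} (hp : 0 < ‖spatial p‖)
    (hh : h m ‖spatial p‖ ≠ 0) (b : Fin 4) :
    ∑ a, christoffel (metric m) a a b p = 0 := by
  rw [sum_christoffel hp hh]
  have hsum : ∀ v w : Fin 4 → ℝ,
      ∑ a, ∑ d, invMetric m p a d * (v a * w d) = v ⬝ᵥ invMetric m p *ᵥ w := by
    intro v w
    simp only [dotProduct, Matrix.mulVec, Finset.mul_sum]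
    exact Finset.sum_congr rfl fun a _ => Finset.sum_congr rfl fun d _ => by ring
  have hsymm : ∀ v w : Fin 4 → ℝ,
      v ⬝ᵥ invMetric m p *ᵥ w = w ⬝ᵥ invMetric m p *ᵥ v := by
    intro v w
    rw [← hsum, ← hsum, Finset.sum_comm]
    refine Finset.sum_congr rfl fun a _ => Finset.sum_congr rfl fun d _ => ?_
    rw [invMetric_symm, mul_comm (v d)]
  have h1 := hsum dt dt
  have h2 := hsum (dr p) (dr p)
  have h3 := hsum (fun a => pderiv b (fun q => dr q a) p) (dr p)
  have h4 := hsum (dr p) (fun a => pderiv b (fun q => dr q a) p)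
  rw [hsymm (dr p)] at h4
  rw [invMetric_mulVec_dt, dotProduct_smul, dt_dotProduct_dt] at h1
  rw [invMetric_mulVec_dr m hp, dotProduct_smul, dr_dotProduct_dr hp] at h2
  rw [invMetric_mulVec_dr m hp, dotProduct_smul, dotProduct_comm,
    dr_dotProduct_pderiv_dr hp] at h3 h4
  simp only [pderiv_metric hp hh, mul_add, mul_sub, mul_left_comm (invMetric m p _ _),
    Finset.sum_add_distrib, Finset.sum_sub_distrib, ← Finset.mul_sum] at *
  rw [h1, h2, h3, h4]
  simp
  field_simp
  ring

/-! ### The normal and the mean curvature of a graph -/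

theorem pderiv_graphFunction_zero {u : E3 → ℝ} {p : Fin 4 → ℝ}
    (hu : DifferentiableAt ℝ u (spatial p)) : pderiv 0 (graphFunction u) p = -1 := by
  have h1 : HasFDerivAt (graphFunction u) _ p :=
    (hu.hasFDerivAt.comp p (hasFDerivAt_spatial p)).sub
      (ContinuousLinearMap.proj (R := ℝ) (φ := fun _ : Fin 4 => ℝ) 0).hasFDerivAt
  rw [pderiv, h1.fderiv]
  simp [spatialL_single_zero]

theorem pderiv_graphFunction_succ {u : E3 → ℝ} {p : Fin 4 → ℝ}
    (hu : DifferentiableAt ℝ u (spatial p)) (i : Fin 3) :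
    pderiv i.succ (graphFunction u) p = fderiv ℝ u (spatial p) (EuclideanSpace.single i 1) := by
  have h1 : HasFDerivAt (graphFunction u) _ p :=
    (hu.hasFDerivAt.comp p (hasFDerivAt_spatial p)).sub
      (ContinuousLinearMap.proj (R := ℝ) (φ := fun _ : Fin 4 => ℝ) 0).hasFDerivAt
  rw [pderiv, h1.fderiv]
  simp [spatialL_single_succ]

/-- The `i`-th partial derivative on `ℝ³`. -/
noncomputable def partialE3 (f : E3 → ℝ) (i : Fin 3) (x : E3) : ℝ :=
  fderiv ℝ f x (EuclideanSpace.single i 1)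

/-- The radial derivative `∂_r f = n · ∇f` with respect to the Euclidean metric. -/
noncomputable def radialDeriv (f : E3 → ℝ) (x : E3) : ℝ :=
  ∑ i, x i / ‖x‖ * partialE3 f i x

/-- The spatial components of the spacetime gradient of `F = u - t`. -/
noncomputable def spatialGrad (m : ℝ) (u : E3 → ℝ) (i : Fin 3) (x : E3) : ℝ :=
  partialE3 u i x - (1 - h m ‖x‖) * radialDeriv u x * (x i / ‖x‖)

/-- The function `-⟨∇F, ∇F⟩` for `F = u - t`, whose inverse is the square of the lapse of the
foliation by the level sets of `F`. -/
noncomputable def lapseSq (m : ℝ) (u : E3 → ℝ) (x : E3) : ℝ :=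
  (h m ‖x‖)⁻¹ + (1 - h m ‖x‖) * radialDeriv u x ^ 2 - ∑ i, partialE3 u i x ^ 2

section GraphNormal

variable {m : ℝ} {u : E3 → ℝ} {p : Fin 4 → ℝ}

theorem dt_dotProduct_pderiv (hu : DifferentiableAt ℝ u (spatial p)) :
    (dt ⬝ᵥ fun b => pderiv b (graphFunction u) p) = -1 := by
  simp [dt, pderiv_graphFunction_zero hu]

theorem dr_dotProduct_pderiv (hu : DifferentiableAt ℝ u (spatial p)) :
    (dr p ⬝ᵥ fun b => pderiv b (graphFunction u) p) = radialDeriv u (spatial p) := by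
  simp only [dr, dotProduct, Fin.sum_univ_succ (n := 3), Fin.cons_zero, Fin.cons_succ,
    pderiv_graphFunction_succ hu, radialDeriv, partialE3]
  ring

theorem grad_zero (hp : 0 < ‖spatial p‖) (hh : h m ‖spatial p‖ ≠ 0)
    (hu : DifferentiableAt ℝ u (spatial p)) :
    grad (metric m) (graphFunction u) p 0 = (h m ‖spatial p‖)⁻¹ := by
  rw [grad, metric_inv hp hh, invMetric_mulVec, dt_dotProduct_pderiv hu, dr_dotProduct_pderiv hu]
  simp [dt, dr, pderiv_graphFunction_zero hu]

theorem grad_succ (hp : 0 < ‖spatial p‖) (hh : h m ‖spatial p‖ ≠ 0)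
    (hu : DifferentiableAt ℝ u (spatial p)) (i : Fin 3) :
    grad (metric m) (graphFunction u) p i.succ = spatialGrad m u i (spatial p) := by
  rw [grad, metric_inv hp hh, invMetric_mulVec, dt_dotProduct_pderiv hu, dr_dotProduct_pderiv hu]
  simp [dt, dr, pderiv_graphFunction_succ hu, spatialGrad, partialE3]
  ring

theorem isUnit_det_metric (hp : 0 < ‖spatial p‖) (hh : h m ‖spatial p‖ ≠ 0) :
    IsUnit (metric m p).det := by
  by_contra hcon
  have h0 := metric_inv hp hh
  rw [Matrix.nonsing_inv_apply_not_isUnit _ hcon] at h0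
  have h1 := invMetric_mulVec_dt m p
  rw [← h0, Matrix.zero_mulVec] at h1
  have h2 := congrFun h1 0
  simp [dt, hh] at h2

theorem metric_mulVec_grad (hp : 0 < ‖spatial p‖) (hh : h m ‖spatial p‖ ≠ 0)
    (F : (Fin 4 → ℝ) → ℝ) :
    metric m p *ᵥ grad (metric m) F p = fun b => pderiv b F p := by
  rw [grad, Matrix.mulVec_mulVec, Matrix.mul_nonsing_inv _ (isUnit_det_metric hp hh),
    Matrix.one_mulVec]

theorem neg_grad_sq (hp : 0 < ‖spatial p‖) (hh : h m ‖spatial p‖ ≠ 0)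
    (hu : DifferentiableAt ℝ u (spatial p)) :
    -(grad (metric m) (graphFunction u) p ⬝ᵥ
      (metric m p *ᵥ grad (metric m) (graphFunction u) p)) = lapseSq m u (spatial p) := by
  rw [metric_mulVec_grad hp hh, dotProduct, Fin.sum_univ_succ]
  simp only [grad_zero hp hh hu, grad_succ hp hh hu, pderiv_graphFunction_zero hu,
    pderiv_graphFunction_succ hu, lapseSq, spatialGrad, radialDeriv, Fin.sum_univ_three,
    partialE3]
  ring

theorem dotProduct_pderiv (F : (Fin 4 → ℝ) → ℝ) (p X : Fin 4 → ℝ) :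
    (X ⬝ᵥ fun b => pderiv b F p) = fderiv ℝ F p X := by
  conv_rhs => rw [pi_eq_sum_univ' X, map_sum]
  simp only [map_smul, dotProduct, pderiv, smul_eq_mul]

/-- A spacelike graph has timelike gradient. If `q = ⟨∇F, ∇F⟩ ≥ 0`, then `q ∂_t + ∇F` is a nonzero
tangent vector with `⟨X, X⟩ = -h q² - q ≤ 0`. -/
theorem lapseSq_pos_of_isSpacelikeAt (hp : 0 < ‖spatial p‖) (hh : 0 < h m ‖spatial p‖)
    (hu : DifferentiableAt ℝ u (spatial p))
    (hs : IsSpacelikeAt (metric m) (graphFunction u) p) : 0 < lapseSq m u (spatial p) := by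
  by_contra! hcon
  rw [← neg_grad_sq hp hh.ne' hu] at hcon
  set V := grad (metric m) (graphFunction u) p with hV
  have hgV := metric_mulVec_grad (m := m) hp hh.ne' (graphFunction u)
  rw [← hV] at hgV
  set q := V ⬝ᵥ (metric m p *ᵥ V) with hq
  have hV0 : V 0 = (h m ‖spatial p‖)⁻¹ := grad_zero hp hh.ne' hu
  have hdtV : dt ⬝ᵥ V = V 0 := by simp [dt]
  have hdF : ∀ X, fderiv ℝ (graphFunction u) p X = X ⬝ᵥ (metric m p *ᵥ V) := by
    intro X
    rw [hgV, dotProduct_pderiv]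
  have hdt : dt ⬝ᵥ (metric m p *ᵥ V) = -1 := by rw [hgV, dt_dotProduct_pderiv hu]
  have hgdt : metric m p *ᵥ dt = -h m ‖spatial p‖ • dt := by
    have h1 := invMetric_mulVec_dt m p
    rw [← metric_inv hp hh.ne'] at h1
    have h2 := congrArg (fun w => -h m ‖spatial p‖ • (metric m p *ᵥ w)) h1
    simp only [Matrix.mulVec_mulVec, Matrix.mul_nonsing_inv _ (isUnit_det_metric hp hh.ne'),
      Matrix.one_mulVec, Matrix.mulVec_smul, smul_smul, neg_mul_neg, mul_inv_cancel₀ hh.ne',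
      one_smul] at h2
    exact h2.symm
  have hq0 : 0 ≤ q := by linarith
  -- as a vector, `dt` has the components of `∂_t`
  have hpos := hs (q • dt + V) (fun h0 => by
    have h1 := congrFun h0 0
    have := inv_pos.2 hh
    simp [dt, hV0] at h1
    linarith) (by rw [hdF, add_dotProduct, smul_dotProduct, hdt, ← hq]; simp)
  rw [Matrix.mulVec_add, Matrix.mulVec_smul, hgdt, add_dotProduct, dotProduct_add, dotProduct_add,
    smul_dotProduct, smul_dotProduct, hdt, ← hq, dotProduct_smul, dotProduct_smul,
    dotProduct_smul, dotProduct_smul, dt_dotProduct_dt, dotProduct_comm V dt, hdtV, hV0] at hpos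
  simp only [smul_eq_mul] at hpos
  have : q * (-h m ‖spatial p‖ * (h m ‖spatial p‖)⁻¹) = -q := by
    rw [neg_mul, mul_inv_cancel₀ hh.ne']; ring
  nlinarith [mul_nonneg hq0 (mul_nonneg hq0 hh.le)]

theorem unitNormal_zero (hp : 0 < ‖spatial p‖) (hh : h m ‖spatial p‖ ≠ 0)
    (hu : DifferentiableAt ℝ u (spatial p)) :
    unitNormal (metric m) (graphFunction u) p 0 =
      (√(lapseSq m u (spatial p)))⁻¹ * (h m ‖spatial p‖)⁻¹ := by
  rw [unitNormal, neg_grad_sq hp hh hu, Pi.smul_apply, grad_zero hp hh hu, smul_eq_mul]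

theorem unitNormal_succ (hp : 0 < ‖spatial p‖) (hh : h m ‖spatial p‖ ≠ 0)
    (hu : DifferentiableAt ℝ u (spatial p)) (i : Fin 3) :
    unitNormal (metric m) (graphFunction u) p i.succ =
      (√(lapseSq m u (spatial p)))⁻¹ * spatialGrad m u i (spatial p) := by
  rw [unitNormal, neg_grad_sq hp hh hu, Pi.smul_apply, grad_succ hp hh hu, smul_eq_mul]

theorem spatial_event (t : ℝ) (x : E3) : spatial (event t x) = x := by
  ext i
  simp [spatial, event]

/-- The mean curvature as a Euclidean divergence: the Christoffel symbols drop out, and the `t`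
component of the unit normal does not depend on `t`. -/
theorem graphMeanCurvature_eq {x : E3} {U : Set E3} (hU : IsOpen U) (hxU : x ∈ U)
    (hx0 : ∀ y ∈ U, 0 < ‖y‖) (hh : ∀ y ∈ U, h m ‖y‖ ≠ 0) (hu : ∀ y ∈ U, DifferentiableAt ℝ u y)
    (hW : DifferentiableAt ℝ (lapseSq m u) x) (hWpos : 0 < lapseSq m u x)
    (hZ : ∀ i, DifferentiableAt ℝ (spatialGrad m u i) x) :
    graphMeanCurvature m u x = (1 / 3) *
      ∑ i, partialE3 (fun y => (√(lapseSq m u y))⁻¹ * spatialGrad m u i y) i x := by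
  have hse := spatial_event (u x) x
  rw [graphMeanCurvature, levelSetMeanCurvature, divergence]
  set p := event (u x) x with hp
  have hW' : DifferentiableAt ℝ (fun y => (√(lapseSq m u y))⁻¹) x :=
    (hW.sqrt hWpos.ne').inv (Real.sqrt_pos.2 hWpos).ne'
  have hnear : ∀ᶠ q in nhds p, spatial q ∈ U :=
    (hasFDerivAt_spatial p).continuousAt.eventually_mem (hU.mem_nhds (by rwa [hse]))
  have hxp : 0 < ‖spatial p‖ := by rw [hse]; exact hx0 x hxU
  have hhp : h m ‖spatial p‖ ≠ 0 := by rw [hse]; exact hh x hxU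
  congr 1
  rw [Finset.sum_add_distrib, Finset.sum_comm]
  simp only [← Finset.sum_mul, sum_christoffel_eq_zero hxp hhp, zero_mul, Finset.sum_const_zero,
    add_zero]
  rw [Fin.sum_univ_succ]
  have h0 : pderiv 0 (fun q => unitNormal (metric m) (graphFunction u) q 0) p = 0 := by
    have hd : DifferentiableAt ℝ
        (fun y : E3 => (√(lapseSq m u y))⁻¹ * (h m ‖y‖)⁻¹) (spatial p) := by
      rw [hse]
      have hn : DifferentiableAt ℝ (fun y : E3 => ‖y‖) x :=
        (hasFDerivAt_norm_E3 (norm_pos_iff.1 (hx0 x hxU))).differentiableAt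
      refine hW'.mul (DifferentiableAt.inv ?_ (hh x hxU))
      simp only [h, div_eq_mul_inv]
      exact ((hn.inv (hx0 x hxU).ne').const_mul (2 * m)).const_sub 1
    rw [← pderiv_zero_comp_spatial hd, pderiv, pderiv]
    congr 1
    refine Filter.EventuallyEq.fderiv_eq ?_
    filter_upwards [hnear] with q hq
    exact unitNormal_zero (hx0 _ hq) (hh _ hq) (hu _ hq)
  rw [h0, zero_add]
  refine Finset.sum_congr rfl fun i _ => ?_
  have hd : DifferentiableAt ℝ
      (fun y : E3 => (√(lapseSq m u y))⁻¹ * spatialGrad m u i y) (spatial p) := by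
    rw [hse]
    exact hW'.mul (hZ i)
  have h1 := pderiv_succ_comp_spatial hd i
  rw [hse] at h1
  rw [partialE3, ← h1, pderiv, pderiv]
  congr 1
  refine Filter.EventuallyEq.fderiv_eq ?_
  filter_upwards [hnear] with q hq
  exact unitNormal_succ (hx0 _ hq) (hh _ hq) (hu _ hq) i

end GraphNormal

/-! ### The graph in terms of its deviation from a null cone -/

theorem fderiv_eq_sum_partialE3 (f : E3 → ℝ) (x v : E3) :
    fderiv ℝ f x v = ∑ i, v i * partialE3 f i x := by
  conv_lhs => rw [← (EuclideanSpace.basisFun (Fin 3) ℝ).sum_repr v, map_sum]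
  simp [partialE3]

theorem sum_coord_sq {x : E3} (hx : 0 < ‖x‖) : ∑ i, (x i / ‖x‖) ^ 2 = 1 := by
  have h1 := EuclideanSpace.norm_sq_eq x
  simp only [Real.norm_eq_abs, sq_abs] at h1
  simp only [div_pow, ← Finset.sum_div]
  rw [← h1]
  field_simp

/-- The derivative `r² ∂_r f`, which is `-∂_s` of the extension of `f` to null infinity. -/
noncomputable def scriDeriv (f : E3 → ℝ) (x : E3) : ℝ := ‖x‖ * fderiv ℝ f x x

/-- The rescaled partial derivative `r ∂_i f`; it extends to null infinity if `f` does, and its values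
there are the components of the gradient on the sphere. -/
noncomputable def angDeriv (f : E3 → ℝ) (i : Fin 3) (x : E3) : ℝ := ‖x‖ * partialE3 f i x

/-- The components of the field `c = Y - 𝐱`, where `s Y` is the spatial part of the spacetime gradient
of `u - t` and `u = r_* - f`. -/
noncomputable def correction (m : ℝ) (f : E3 → ℝ) (i : Fin 3) (x : E3) : ℝ :=
  2 * m * ‖x‖⁻¹ ^ 2 * scriDeriv f x * (x i / ‖x‖) - angDeriv f i x

/-- The field `Y = 𝐱 + c`; `s Y` is the spatial part of the spacetime gradient of `u - t`, where
`u = r_* - f`. -/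
noncomputable def flowField (m : ℝ) (f : E3 → ℝ) (x : E3) : E3 :=
  x + WithLp.toLp 2 fun i => correction m f i x

/-- The function `L = -⟨∇F, ∇F⟩` of the unphysical metric, in the exterior region, as a function of
`𝐱`. The first and last terms are `-2 P_s` and `2m s³ P_s²`; the middle one is
`-r² |∇f|² = -|∇̃P|² - s² P_s²`. -/
noncomputable def bulkL (m : ℝ) (f : E3 → ℝ) (x : E3) : ℝ :=
  2 * scriDeriv f x - ∑ i, angDeriv f i x ^ 2 + 2 * m * ‖x‖⁻¹ ^ 3 * scriDeriv f x ^ 2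

theorem radialDeriv_eq {f : E3 → ℝ} {x : E3} (hx : 0 < ‖x‖) :
    radialDeriv f x = ‖x‖⁻¹ ^ 2 * scriDeriv f x := by
  rw [radialDeriv, scriDeriv, fderiv_eq_sum_partialE3]
  simp only [Fin.sum_univ_three]
  field_simp

theorem hasDerivAt_tortoise {m r : ℝ} (hm : 0 ≤ m) (hr : 2 * m < r) :
    HasDerivAt (tortoise m) (h m r)⁻¹ r := by
  have hr0 : 0 < r := by linarith
  rcases hm.eq_or_lt with rfl | hm
  · have : tortoise 0 = id := by funext r; simp [tortoise]
    rw [this]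
    simpa [h] using hasDerivAt_id r
  · have h1 : HasDerivAt (fun r => r / (2 * m) - 1) (1 / (2 * m)) r :=
      ((hasDerivAt_id r).div_const _).sub_const _
    have hpos : 0 < r / (2 * m) - 1 := by
      rw [sub_pos, lt_div_iff₀ (by positivity)]; linarith
    have h2 := (hasDerivAt_id r).add ((h1.log hpos.ne').const_mul (2 * m))
    have h3 : tortoise m = id + fun r => 2 * m * Real.log (r / (2 * m) - 1) := by
      funext r
      simp [tortoise, Real.log_abs]
    rw [h3]
    refine h2.congr_deriv ?_
    have h4 : r - 2 * m ≠ 0 := by linarith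
    rw [h, one_sub_div hr0.ne', inv_div, div_sub_one (by positivity)]
    field_simp
    ring

section Exterior

variable {m s₀ : ℝ} {u p f : E3 → ℝ} {x : E3}

theorem h_pos (hs₀ : 0 < s₀) (hms₀ : 2 * m * s₀ ≤ 1) (hx : s₀⁻¹ < ‖x‖) :
    2 * m < ‖x‖ ∧ 0 < h m ‖x‖ := by
  have h0 := pos_of_exterior hs₀ hx
  have h1 : 2 * m < ‖x‖ := by
    refine lt_of_le_of_lt ?_ hx
    exact le_of_mul_le_mul_right (by rwa [inv_mul_cancel₀ hs₀.ne']) hs₀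
  refine ⟨h1, ?_⟩
  rw [h, sub_pos, div_lt_one h0]
  exact h1

section Graph

variable (hm : 0 ≤ m) (hs₀ : 0 < s₀) (hms₀ : 2 * m * s₀ ≤ 1) (hp : ExtendsToInfinity s₀ p)
  (hup : ∀ x, s₀⁻¹ < ‖x‖ → u x = tortoise m ‖x‖ - p x)
include hm hs₀ hms₀ hp hup

theorem hasFDerivAt_graph (hx : s₀⁻¹ < ‖x‖) :
    HasFDerivAt u ((h m ‖x‖)⁻¹ • ‖x‖⁻¹ • innerSL ℝ x - fderiv ℝ p x) x := by
  have h0 := pos_of_exterior hs₀ hx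
  have h1 := (hasDerivAt_tortoise hm (h_pos hs₀ hms₀ hx).1).comp_hasFDerivAt x
    (hasFDerivAt_norm_E3 (norm_pos_iff.1 h0))
  refine (h1.sub (hp.differentiableAt hs₀ hx).hasFDerivAt).congr_of_eventuallyEq ?_
  filter_upwards [(isOpen_exterior s₀).mem_nhds hx] with y hy
  exact hup y hy

theorem partialE3_graph (hx : s₀⁻¹ < ‖x‖) (i : Fin 3) :
    partialE3 u i x = (h m ‖x‖)⁻¹ * (x i / ‖x‖) - partialE3 p i x := by
  rw [partialE3, (hasFDerivAt_graph hm hs₀ hms₀ hp hup hx).fderiv, partialE3]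
  simp only [sub_apply, smul_apply, innerSL_apply_apply, smul_eq_mul,
    EuclideanSpace.inner_single_right, Real.ringHom_apply, one_mul]
  ring

theorem radialDeriv_graph (hx : s₀⁻¹ < ‖x‖) :
    radialDeriv u x = (h m ‖x‖)⁻¹ - radialDeriv p x := by
  have h1 := sum_coord_sq (pos_of_exterior hs₀ hx)
  simp only [radialDeriv, partialE3_graph hm hs₀ hms₀ hp hup hx, Fin.sum_univ_three] at h1 ⊢
  linear_combination (h m ‖x‖)⁻¹ * h1

/-- The conformal relation `-⟨∇F, ∇F⟩_g = s² L`. -/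
theorem lapseSq_graph (hx : s₀⁻¹ < ‖x‖) :
    lapseSq m u x = ‖x‖⁻¹ ^ 2 * bulkL m p x := by
  have h0 := pos_of_exterior hs₀ hx
  have hh := (h_pos hs₀ hms₀ hx).2
  have h1 := sum_coord_sq h0
  have h2 : ∑ i, x i / ‖x‖ * partialE3 p i x = ‖x‖⁻¹ ^ 2 * scriDeriv p x := radialDeriv_eq h0
  have h3 : ∑ i, angDeriv p i x ^ 2 = ‖x‖ ^ 2 * ∑ i, partialE3 p i x ^ 2 := by
    simp only [angDeriv, mul_pow, Finset.mul_sum]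
  have h4 : ∑ i, partialE3 u i x ^ 2 = (h m ‖x‖)⁻¹ ^ 2
      - 2 * (h m ‖x‖)⁻¹ * (‖x‖⁻¹ ^ 2 * scriDeriv p x) + ∑ i, partialE3 p i x ^ 2 := by
    simp only [partialE3_graph hm hs₀ hms₀ hp hup hx, Fin.sum_univ_three] at h1 h2 ⊢
    linear_combination (h m ‖x‖)⁻¹ ^ 2 * h1 - 2 * (h m ‖x‖)⁻¹ * h2
  have h5 : 1 - h m ‖x‖ = 2 * m * ‖x‖⁻¹ := by rw [h]; ring
  rw [lapseSq, radialDeriv_graph hm hs₀ hms₀ hp hup hx, radialDeriv_eq h0, h4, bulkL, h3]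
  have h6 : ‖x‖⁻¹ ^ 2 * ‖x‖ ^ 2 = 1 := by rw [← mul_pow, inv_mul_cancel₀ h0.ne', one_pow]
  have h7 : (1 - h m ‖x‖) * (h m ‖x‖)⁻¹ = (h m ‖x‖)⁻¹ - 1 := by
    rw [sub_mul, mul_inv_cancel₀ hh.ne', one_mul]
  linear_combination ((h m ‖x‖)⁻¹ - 2 * (‖x‖⁻¹ ^ 2 * scriDeriv p x)) * h7
    + (‖x‖⁻¹ ^ 2 * scriDeriv p x) ^ 2 * h5 + (∑ i, partialE3 p i x ^ 2) * h6

theorem spatialGrad_graph (hx : s₀⁻¹ < ‖x‖) (i : Fin 3) :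
    spatialGrad m u i x = ‖x‖⁻¹ * flowField m p x i := by
  have h0 := pos_of_exterior hs₀ hx
  have hh := (h_pos hs₀ hms₀ hx).2
  rw [spatialGrad, radialDeriv_graph hm hs₀ hms₀ hp hup hx,
    partialE3_graph hm hs₀ hms₀ hp hup hx, radialDeriv_eq h0]
  have h5 : 1 - h m ‖x‖ = 2 * m * ‖x‖⁻¹ := by rw [h]; ring
  have h6 : ‖x‖⁻¹ * ‖x‖ = 1 := inv_mul_cancel₀ h0.ne'
  have h7 : (1 - h m ‖x‖) * (h m ‖x‖)⁻¹ = (h m ‖x‖)⁻¹ - 1 := by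
    rw [sub_mul, mul_inv_cancel₀ hh.ne', one_mul]
  simp only [flowField, correction, angDeriv, PiLp.add_apply]
  linear_combination - (x i / ‖x‖) * h7 + ‖x‖⁻¹ ^ 2 * scriDeriv p x * (x i / ‖x‖) * h5
    + partialE3 p i x * h6

end Graph

/-! ### A minimum principle -/

/-- A minimum principle on the exterior of a ball, for a field `Y` pointing outwards: if `c ≤ L` holds on
the sphere `|x| = R` and at all points where `dL(Y) ≤ 0`, then it holds everywhere. No behaviour at
infinity is required, since `-Y` points into the annulus at points of its outer boundary. -/
theorem le_of_forall_deriv_nonpos {L : E3 → ℝ} {Y : E3 → E3} {R c : ℝ}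
    (hL : ∀ x, R ≤ ‖x‖ → DifferentiableAt ℝ L x)
    (hY : ∀ x, R < ‖x‖ → 0 < inner ℝ x (Y x))
    (hbdry : ∀ x, ‖x‖ = R → c ≤ L x)
    (hcrit : ∀ x, R < ‖x‖ → fderiv ℝ L x (Y x) ≤ 0 → c ≤ L x) {x : E3} (hx : R ≤ ‖x‖) :
    c ≤ L x := by
  set K : Set E3 := Metric.closedBall 0 ‖x‖ ∩ {z | R ≤ ‖z‖} with hKdef
  have hK : IsCompact K :=
    (isCompact_closedBall 0 ‖x‖).inter_right (isClosed_le continuous_const continuous_norm)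
  have hxK : x ∈ K := ⟨by simp, hx⟩
  obtain ⟨z, hzK, hz⟩ := hK.exists_isMinOn ⟨x, hxK⟩
    (fun y hy => (hL y hy.2).continuousAt.continuousWithinAt)
  refine le_trans ?_ (hz hxK)
  have hRz : R ≤ ‖z‖ := hzK.2
  rcases hRz.eq_or_lt with hzR | hzR
  · exact hbdry z hzR.symm
  refine hcrit z hzR ?_
  have hcone : -Y z ∈ posTangentConeAt K z := by
    refine mem_posTangentConeAt_of_frequently_mem (Filter.Eventually.frequently ?_)
    have h1 : ∀ᶠ t : ℝ in nhdsWithin 0 (Set.Ioi 0), R < ‖z + t • -Y z‖ := by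
      have : ContinuousAt (fun t : ℝ => ‖z + t • -Y z‖) 0 := by fun_prop
      refine nhdsWithin_le_nhds (this.eventually_const_lt ?_)
      simpa using hzR
    have h2 : ∀ᶠ t : ℝ in nhdsWithin 0 (Set.Ioi 0), t * ‖Y z‖ ^ 2 < 2 * inner ℝ z (Y z) := by
      have : ContinuousAt (fun t : ℝ => t * ‖Y z‖ ^ 2) 0 := by fun_prop
      refine nhdsWithin_le_nhds (this.eventually_lt_const ?_)
      have := hY z hzR
      simpa using this
    filter_upwards [h1, h2, self_mem_nhdsWithin] with t ht1 ht2 ht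
    refine ⟨?_, ht1.le⟩
    have ht0 : (0 : ℝ) < t := ht
    have hzx : ‖z‖ ≤ ‖x‖ := by simpa using hzK.1
    rw [mem_closedBall_zero_iff]
    refine le_trans (le_of_sq_le_sq ?_ (norm_nonneg z)) hzx
    rw [norm_add_sq_real, inner_smul_right, inner_neg_right, norm_smul, norm_neg,
      Real.norm_of_nonneg ht0.le]
    nlinarith
  have := hz.localize.hasFDerivWithinAt_nonneg
    (hL z hRz).hasFDerivAt.hasFDerivWithinAt hcone
  rw [map_neg] at this
  linarith

/-! ### The equation for the mean curvature -/

open Filter Topology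

namespace ExtendsToInfinity

theorem scriDeriv (hs₀ : 0 < s₀) (hf : ExtendsToInfinity s₀ f) :
    ExtendsToInfinity s₀ (scriDeriv f) := hf.radial hs₀

theorem angDeriv (hs₀ : 0 < s₀) (hf : ExtendsToInfinity s₀ f) (i : Fin 3) :
    ExtendsToInfinity s₀ (angDeriv f i) := hf.angular hs₀ _

theorem correction (m : ℝ) (hs₀ : 0 < s₀) (hf : ExtendsToInfinity s₀ f) (i : Fin 3) :
    ExtendsToInfinity s₀ (correction m f i) :=
  ((((const (2 * m)).mul (inv_norm.pow 2)).mul (hf.scriDeriv hs₀)).mul (coord i)).sub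
    (hf.angDeriv hs₀ i)

theorem bulkL (m : ℝ) (hs₀ : 0 < s₀) (hf : ExtendsToInfinity s₀ f) :
    ExtendsToInfinity s₀ (bulkL m f) :=
  (((const 2).mul (hf.scriDeriv hs₀)).sub (sum fun i => (hf.angDeriv hs₀ i).pow 2)).add
    (((const (2 * m)).mul (inv_norm.pow 3)).mul ((hf.scriDeriv hs₀).pow 2))

end ExtendsToInfinity

/-- The rescaled divergence `r div c` of the field `c = Y - 𝐱`. -/
noncomputable def correctionDiv (m : ℝ) (p : E3 → ℝ) (x : E3) : ℝ :=
  ∑ i, angDeriv (correction m p i) i x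

/-- The rescaled derivative `r dL(Y)`, split according to `Y = 𝐱 + c`. -/
noncomputable def flowDerivL (m : ℝ) (p : E3 → ℝ) (x : E3) : ℝ :=
  scriDeriv (bulkL m p) x + ∑ i, correction m p i x * angDeriv (bulkL m p) i x

theorem fderiv_bulkL_flowField (hx : 0 < ‖x‖) :
    fderiv ℝ (bulkL m p) x (flowField m p x) = ‖x‖⁻¹ * flowDerivL m p x := by
  rw [flowField, map_add, fderiv_eq_sum_partialE3 _ x (WithLp.toLp 2 fun i => correction m p i x),
    flowDerivL, scriDeriv]
  simp only [angDeriv, Fin.sum_univ_three]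
  field_simp

theorem inner_flowField (hx : 0 < ‖x‖) :
    inner ℝ x (flowField m p x) = ‖x‖ * (‖x‖ + ∑ i, x i / ‖x‖ * correction m p i x) := by
  rw [flowField, inner_add_right, real_inner_self_eq_norm_sq]
  simp only [PiLp.inner_apply, Fin.sum_univ_three, RCLike.inner_apply, conj_trivial]
  field_simp

/-- The equation for `L`: since the unit normal has spatial part `L^{-1/2} Y`, its divergence gives
`3 H L^{3/2} = (3 + div c) L - ½ dL(Y)`. -/
theorem graphMeanCurvature_mul (hm : 0 ≤ m) (hs₀ : 0 < s₀) (hms₀ : 2 * m * s₀ ≤ 1)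
    (hp : ExtendsToInfinity s₀ p) (hup : ∀ x, s₀⁻¹ < ‖x‖ → u x = tortoise m ‖x‖ - p x)
    (hx : s₀⁻¹ < ‖x‖) (hL : 0 < bulkL m p x) :
    3 * graphMeanCurvature m u x * √(bulkL m p x) ^ 3 =
      (3 + ‖x‖⁻¹ * correctionDiv m p x) * bulkL m p x - 1 / 2 * (‖x‖⁻¹ * flowDerivL m p x) := by
  have h0 := pos_of_exterior hs₀ hx
  have hnhds := (isOpen_exterior s₀).mem_nhds hx
  have hLd := (hp.bulkL m hs₀).differentiableAt hs₀ hx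
  have hinv := (ExtendsToInfinity.inv_norm (s₀ := s₀)).differentiableAt hs₀ hx
  have hcd := fun i => (hp.correction m hs₀ i).differentiableAt hs₀ hx
  have hYd : ∀ i, HasFDerivAt (fun y => flowField m p y i)
      (EuclideanSpace.proj (𝕜 := ℝ) i + fderiv ℝ (correction m p i) x) x := fun i =>
    (EuclideanSpace.proj (𝕜 := ℝ) i).hasFDerivAt.add (hcd i).hasFDerivAt
  have hWeq : lapseSq m u =ᶠ[𝓝 x] fun y => ‖y‖⁻¹ ^ 2 * bulkL m p y := by
    filter_upwards [hnhds] with y hy using lapseSq_graph hm hs₀ hms₀ hp hup hy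
  have hZeq : ∀ i, spatialGrad m u i =ᶠ[𝓝 x] fun y => ‖y‖⁻¹ * flowField m p y i := by
    intro i
    filter_upwards [hnhds] with y hy using spatialGrad_graph hm hs₀ hms₀ hp hup hy i
  rw [graphMeanCurvature_eq (isOpen_exterior s₀) hx (fun y hy => pos_of_exterior hs₀ hy)
    (fun y hy => (h_pos hs₀ hms₀ hy).2.ne')
    (fun y hy => (hasFDerivAt_graph hm hs₀ hms₀ hp hup hy).differentiableAt)
    (((hinv.pow 2).mul hLd).congr_of_eventuallyEq hWeq)
    (by rw [hWeq.eq_of_nhds]; positivity)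
    (fun i => (hinv.mul (hYd i).differentiableAt).congr_of_eventuallyEq (hZeq i))]
  set q := √(bulkL m p x) with hq
  have hq0 : 0 < q := Real.sqrt_pos.2 hL
  have hqq : q ^ 2 = bulkL m p x := Real.sq_sqrt hL.le
  have hpart : ∀ i, partialE3 (fun y => (√(lapseSq m u y))⁻¹ * spatialGrad m u i y) i x =
      q⁻¹ * (1 + partialE3 (correction m p i) i x)
        - 1 / 2 * q⁻¹ ^ 3 * (flowField m p x i * partialE3 (bulkL m p) i x) := by
    intro i
    have heq : (fun y => (√(lapseSq m u y))⁻¹ * spatialGrad m u i y) =ᶠ[𝓝 x]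
        fun y => (√(bulkL m p y))⁻¹ * flowField m p y i := by
      filter_upwards [hWeq, hZeq i, hnhds] with y h1 h2 hy
      have hy1 := pos_of_exterior hs₀ hy
      have hy0 := inv_pos.2 hy1
      rw [h1, h2, Real.sqrt_mul (sq_nonneg _), Real.sqrt_sq hy0.le]
      field_simp
    have hsq := (hasDerivAt_inv hq0.ne').comp_hasFDerivAt x (hLd.hasFDerivAt.sqrt hL.ne')
    have hprod := hsq.mul (hYd i)
    rw [partialE3, heq.fderiv_eq]
    have hprod' : HasFDerivAt (fun y => (√(bulkL m p y))⁻¹ * flowField m p y i) _ x := hprod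
    rw [hprod'.fderiv]
    simp [partialE3, ← hq]
    field_simp
    ring
  simp only [hpart, Finset.sum_sub_distrib, ← Finset.mul_sum, Finset.sum_add_distrib]
  rw [← fderiv_eq_sum_partialE3, fderiv_bulkL_flowField h0]
  have hd : ‖x‖⁻¹ * correctionDiv m p x = ∑ i, partialE3 (correction m p i) i x := by
    simp only [correctionDiv, angDeriv, ← Finset.mul_sum]
    field_simp
  rw [hd, ← hqq]
  simp
  field_simp

/-! ### The limit at null infinity and the lower bound -/

theorem tendsto_ray {s₀ : ℝ} (hs₀ : 0 < s₀) (hf : ExtendsToInfinity s₀ f) {y : E3}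
    (hy : ‖y‖ = 1) : ∃ a, Tendsto (fun l : ℝ => f (l • y)) atTop (𝓝 a) := by
  obtain ⟨Φ, hΦ⟩ := hf
  exact ⟨_, hΦ.tendsto hs₀ hy⟩

theorem tendsto_inv_norm_ray {y : E3} (hy : ‖y‖ = 1) :
    Tendsto (fun l : ℝ => ‖l • y‖⁻¹) atTop (𝓝 0) := by
  refine tendsto_inv_atTop_zero.congr' ?_
  filter_upwards [eventually_gt_atTop 0] with l hl
  rw [norm_smul, hy, mul_one, Real.norm_of_nonneg hl.le]

theorem norm_sphereGrad_sq (g : S2 → ℝ) (y : S2) :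
    ‖sphereGrad g y‖ ^ 2 = ∑ i, partialE3 (fun x => g (radialProj x)) i y ^ 2 := by
  rw [EuclideanSpace.norm_sq_eq]
  refine Finset.sum_congr rfl fun i _ => ?_
  rw [Real.norm_eq_abs, sq_abs, partialE3, ← InnerProductSpace.toDual_symm_apply,
    EuclideanSpace.inner_single_right]
  simp [sphereGrad, gradient]

/-- The limit of `L` at null infinity is `-2 P_s - |∇̃P|²`. -/
theorem tendsto_bulkL {P : S2 × ℝ → ℝ} (hs₀ : 0 < s₀) (hP : SmoothUpToNullInfinity s₀ P)
    (y : S2) :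
    Tendsto (fun l : ℝ => bulkL m (fun x => P (radialProj x, ‖x‖⁻¹)) (l • (y : E3))) atTop
      (𝓝 (nullL m P y 0)) := by
  have hy : ‖(y : E3)‖ = 1 := by simp
  have hy0 : (y : E3) ≠ 0 := by intro h; simp [h] at hy
  have hE := hP.isExtension hs₀
  set p : E3 → ℝ := fun x => P (radialProj x, ‖x‖⁻¹)
  set Φ : E3 × ℝ → ℝ := fun z => P (radialProj z.1, z.2)
  have hmem : ((y : E3), (0 : ℝ)) ∈ collar s₀ := ⟨hy0, le_rfl, hs₀⟩
  have hΦ : HasFDerivWithinAt Φ (fderivWithin ℝ Φ (collar s₀) (y, 0)) (collar s₀) (y, 0) :=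
    ((hE.1 _ hmem).differentiableWithinAt (by simp)).hasFDerivWithinAt
  set D := fderivWithin ℝ Φ (collar s₀) ((y : E3), (0 : ℝ)) with hD
  have hs : derivWithin (fun t => P (y, t)) (Set.Ici 0) 0 = D (0, 1) := by
    have h1 : HasDerivWithinAt (fun t : ℝ => ((y : E3), t)) ((0 : E3), (1 : ℝ)) (Set.Ico 0 s₀) 0 :=
      ((hasDerivAt_const 0 (y : E3)).prodMk (hasDerivAt_id 0)).hasDerivWithinAt
    have h2 := hΦ.comp_hasDerivWithinAt 0 h1 (fun t ht => ⟨hy0, ht⟩)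
    have h3 := h2.mono_of_mem_nhdsWithin (Ico_mem_nhdsGE hs₀)
    have h4 : (Φ ∘ fun t : ℝ => ((y : E3), t)) = fun t => P (y, t) := by
      funext t
      have := radialProj_smul y one_pos
      rw [one_smul] at this
      simp [Φ, this]
    rw [h4] at h3
    exact h3.derivWithin (uniqueDiffOn_Ici 0 0 Set.self_mem_Ici)
  have hang : HasFDerivAt (fun x : E3 => P (radialProj x, 0)) (D ∘L .inl ℝ E3 ℝ) y := by
    have h1 : HasFDerivWithinAt (fun x : E3 => (x, (0 : ℝ))) (.inl ℝ E3 ℝ) {0}ᶜ y :=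
      ((hasFDerivAt_id (y : E3)).prodMk (hasFDerivAt_const (0 : ℝ) (y : E3))).hasFDerivWithinAt
    have hmaps : Set.MapsTo (fun x : E3 => (x, (0 : ℝ))) {0}ᶜ (collar s₀) :=
      fun x hx => ⟨hx, le_rfl, hs₀⟩
    have h2 := hΦ.comp (y : E3) h1 hmaps
    exact h2.hasFDerivAt (isOpen_compl_singleton.mem_nhds hy0)
  -- the extension is constant along rays
  have hray : D ((y : E3), 0) = 0 := by
    have h1 : HasDerivAt (fun t : ℝ => t • (y : E3)) (y : E3) 1 := by
      simpa using (hasDerivAt_id (1 : ℝ)).smul_const (y : E3)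
    have h2 : HasFDerivAt (fun x : E3 => P (radialProj x, 0)) (D ∘L .inl ℝ E3 ℝ)
        ((1 : ℝ) • (y : E3)) := by rwa [one_smul]
    have h3 := h2.comp_hasDerivAt 1 h1
    have h4 := (hasDerivAt_const (1 : ℝ) (P (y, 0))).congr_of_eventuallyEq
      (f₁ := (fun x : E3 => P (radialProj x, 0)) ∘ fun t : ℝ => t • (y : E3)) (by
        filter_upwards [eventually_gt_nhds one_pos] with t ht
        simp [radialProj_smul y ht])
    simpa using h3.unique h4
  have ha : ∀ i, Tendsto (fun l : ℝ => angDeriv p i (l • (y : E3))) atTop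
      (𝓝 (partialE3 (fun x => P (radialProj x, 0)) i y)) := by
    intro i
    have h1 := (hE.angular hs₀ (EuclideanSpace.single i 1)).tendsto hs₀ hy
    refine (congrArg 𝓝 ?_).subst (motive := Tendsto _ atTop) h1
    rw [partialE3, hang.fderiv]
    simp only [zero_mul, neg_zero, ← hD]
    set a := inner ℝ (y : E3) (EuclideanSpace.single i (1 : ℝ))
    have h2 : ((EuclideanSpace.single i (1 : ℝ) - a • (y : E3), 0) : E3 × ℝ) =
      (EuclideanSpace.single i 1, 0) - a • ((y : E3), 0) := by ext <;> simp
    rw [h2, map_sub, map_smul, hray]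
    simp
  have hk : Tendsto (fun l : ℝ => scriDeriv p (l • (y : E3))) atTop (𝓝 (-D (0, 1))) :=
    (hE.radial hs₀).tendsto hs₀ hy
  have hinv := tendsto_inv_norm_ray hy
  have hlim := ((hk.const_mul 2).sub (tendsto_finsetSum Finset.univ fun i _ => (ha i).pow 2)).add
    (((hinv.pow 3).const_mul (2 * m)).mul (hk.pow 2))
  refine (congrArg 𝓝 ?_).subst (motive := Tendsto _ atTop) hlim
  rw [nullL, unphysicalNormSq, hs, norm_sphereGrad_sq]
  ring

/-- `L` is bounded below by a positive constant near null infinity. -/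
theorem exists_pos_le_bulkL (hm : 0 ≤ m) (hs₀ : 0 < s₀) (hms₀ : 2 * m * s₀ ≤ 1)
    (hp : ExtendsToInfinity s₀ p) (hup : ∀ x, s₀⁻¹ < ‖x‖ → u x = tortoise m ‖x‖ - p x)
    (hL : ∀ x, s₀⁻¹ < ‖x‖ → 0 < bulkL m p x)
    (hH : ExtendsToInfinity s₀ (graphMeanCurvature m u)) :
    ∃ c R, 0 < c ∧ ∀ x, R ≤ ‖x‖ → c ≤ bulkL m p x := by
  have hLe := hp.bulkL m hs₀
  have hR' : s₀⁻¹ < s₀⁻¹ + 1 := by linarith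
  have hdiv : ExtendsToInfinity s₀ (correctionDiv m p) :=
    ExtendsToInfinity.sum fun i => (hp.correction m hs₀ i).angDeriv hs₀ i
  have hrad : ExtendsToInfinity s₀ (fun x => ∑ i, x i / ‖x‖ * correction m p i x) :=
    ExtendsToInfinity.sum fun i => (ExtendsToInfinity.coord i).mul (hp.correction m hs₀ i)
  obtain ⟨C₁, hC₁⟩ := hdiv.bounded hs₀ hR'
  obtain ⟨C₂, hC₂⟩ := hrad.bounded hs₀ hR'
  obtain ⟨B, hB⟩ := hH.bounded hs₀ hR'
  -- for `r ≥ R`, both `⟨x, Y⟩ > 0` and `3 + div c ≥ 2`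
  set R : ℝ := max (s₀⁻¹ + 1) (max C₁ C₂) with hR
  have hRs : s₀⁻¹ + 1 ≤ R := le_max_left _ _
  have hR1 : C₁ ≤ R := (le_max_left _ _).trans (le_max_right _ _)
  have hR2 : C₂ ≤ R := (le_max_right _ _).trans (le_max_right _ _)
  have hs0' := inv_pos.2 hs₀
  have hRpos : 0 < R := by linarith
  have hext : ∀ x : E3, R ≤ ‖x‖ → s₀⁻¹ < ‖x‖ := fun x hx => by linarith
  have hdiff : ∀ x, R ≤ ‖x‖ → DifferentiableAt ℝ (bulkL m p) x :=
    fun x hx => hLe.differentiableAt hs₀ (hext x hx)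
  obtain ⟨z, hzR, hz⟩ := (isCompact_sphere (0 : E3) R).exists_isMinOn
    (NormedSpace.sphere_nonempty.2 hRpos.le) (f := bulkL m p) (fun y hy =>
      (hdiff y (mem_sphere_zero_iff_norm.1 hy).ge).continuousAt.continuousWithinAt)
  have hzpos : 0 < bulkL m p z := hL z (hext z (mem_sphere_zero_iff_norm.1 hzR).ge)
  -- a positive bound for `H`; `max B 1` because `B` is not known to be positive
  set B' : ℝ := max B 1
  have hB'pos : 0 < B' := lt_of_lt_of_le one_pos (le_max_right _ _)
  refine ⟨min (bulkL m p z) ((2 / (3 * B')) ^ 2), R, lt_min hzpos (by positivity), fun x hx => ?_⟩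
  refine le_of_forall_deriv_nonpos (Y := flowField m p) hdiff (fun y hy => ?_) (fun y hy => ?_)
    (fun y hy hder => ?_) hx
  · have hy0 : 0 < ‖y‖ := hRpos.trans hy
    rw [inner_flowField hy0]
    have := (abs_le.1 (hC₂ y (hRs.trans hy.le))).1
    exact mul_pos hy0 (by linarith)
  · exact (min_le_left _ _).trans (hz (mem_sphere_zero_iff_norm.2 hy))
  · refine (min_le_right _ _).trans ?_
    have hy0 : 0 < ‖y‖ := hRpos.trans hy
    have hyL := hL y (hext y hy.le)
    have key := graphMeanCurvature_mul hm hs₀ hms₀ hp hup (hext y hy.le) hyL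
    rw [fderiv_bulkL_flowField hy0] at hder
    have h1 : -1 ≤ ‖y‖⁻¹ * correctionDiv m p y := by
      have h2 := (abs_le.1 (hC₁ y (hRs.trans hy.le))).1
      rw [inv_mul_eq_div, le_div_iff₀ hy0]
      linarith
    have h3 : graphMeanCurvature m u y ≤ B' :=
      ((abs_le.1 (hB y (hRs.trans hy.le))).2).trans (le_max_left _ _)
    set q := √(bulkL m p y) with hq
    have hq0 : 0 < q := Real.sqrt_pos.2 hyL
    have hqq : q ^ 2 = bulkL m p y := Real.sq_sqrt hyL.le
    rw [← hqq] at key ⊢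
    have h4 : 2 * q ^ 2 ≤ 3 * B' * q * q ^ 2 := by
      have h5 : 0 ≤ (1 + ‖y‖⁻¹ * correctionDiv m p y) * q ^ 2 :=
        mul_nonneg (by linarith) (by positivity)
      have h6 : graphMeanCurvature m u y * q ^ 3 ≤ B' * q ^ 3 :=
        mul_le_mul_of_nonneg_right h3 (by positivity)
      nlinarith
    have h7 : 2 ≤ 3 * B' * q := le_of_mul_le_mul_right h4 (by positivity)
    have h8 : 2 / (3 * B') ≤ q := by
      rw [div_le_iff₀ (by positivity)]
      linarith
    gcongr

end Exterior

end Schwarzschild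

open Schwarzschild Filter in
theorem proposition3p3 (m : ℝ) (hm : 0 ≤ m) (s₀ : ℝ) (hs₀ : 0 < s₀) (hms₀ : 2 * m * s₀ ≤ 1)
    (u : Schwarzschild.E3 → ℝ) (P H : Schwarzschild.S2 × ℝ → ℝ)
    (hPu : ∀ (y : Schwarzschild.S2), ∀ s ∈ Set.Ioo 0 s₀,
      P (y, s) = Schwarzschild.tortoise m s⁻¹ - u (s⁻¹ • (y : Schwarzschild.E3)))
    (hP : Schwarzschild.SmoothUpToNullInfinity s₀ P)
    (hspace : ∀ (y : Schwarzschild.S2), ∀ s ∈ Set.Ioo 0 s₀,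
      Schwarzschild.IsSpacelikeGraphAt m u (s⁻¹ • (y : Schwarzschild.E3)))
    (hHu : ∀ (y : Schwarzschild.S2), ∀ s ∈ Set.Ioo 0 s₀,
      H (y, s) = Schwarzschild.graphMeanCurvature m u (s⁻¹ • (y : Schwarzschild.E3)))
    (hH : Schwarzschild.SmoothUpToNullInfinity s₀ H)
    (hHpos : ∀ (y : Schwarzschild.S2), ∀ s ∈ Set.Ico 0 s₀, 0 < H (y, s)) :
    ∀ y : Schwarzschild.S2, Schwarzschild.nullL m P y 0 = (H (y, 0) ^ 2)⁻¹ := by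
  intro y
  set p : E3 → ℝ := fun x => P (radialProj x, ‖x‖⁻¹) with hpdef
  have hp : ExtendsToInfinity s₀ p := ⟨_, hP.isExtension hs₀⟩
  -- an exterior point `x` is the point `s⁻¹ • y` with `y = x / |x|` and `s = 1 / |x|`
  have hpolar : ∀ x : E3, s₀⁻¹ < ‖x‖ → ‖x‖⁻¹ ∈ Set.Ioo 0 s₀ ∧
      (‖x‖⁻¹)⁻¹ • (radialProj x : E3) = x := fun x hx =>
    ⟨(mem_collar hs₀ hx).2, by
      rw [inv_inv, smul_radialProj (norm_pos_iff.1 (pos_of_exterior hs₀ hx))]⟩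
  have hup : ∀ x, s₀⁻¹ < ‖x‖ → u x = tortoise m ‖x‖ - p x := by
    intro x hx
    obtain ⟨h1, h2⟩ := hpolar x hx
    have h3 := hPu (radialProj x) _ h1
    rw [h2, inv_inv] at h3
    rw [hpdef]
    simp only [h3]
    ring
  have hL : ∀ x, s₀⁻¹ < ‖x‖ → 0 < bulkL m p x := by
    intro x hx
    have h0 := pos_of_exterior hs₀ hx
    obtain ⟨h1, h2⟩ := hpolar x hx
    have h3 := hspace (radialProj x) _ h1
    rw [h2] at h3
    have hse := spatial_event (u x) x
    have h4 := lapseSq_pos_of_isSpacelikeAt (by rwa [hse])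
      (by rw [hse]; exact (h_pos hs₀ hms₀ hx).2)
      (by rw [hse]; exact (hasFDerivAt_graph hm hs₀ hms₀ hp hup hx).differentiableAt) h3
    rw [hse, lapseSq_graph hm hs₀ hms₀ hp hup hx] at h4
    exact pos_of_mul_pos_right h4 (by positivity)
  have hHeq : ∀ x, s₀⁻¹ < ‖x‖ → graphMeanCurvature m u x = H (radialProj x, ‖x‖⁻¹) := by
    intro x hx
    obtain ⟨h1, h2⟩ := hpolar x hx
    rw [hHu _ _ h1, h2]
  have hHE : IsExtension s₀ _ (graphMeanCurvature m u) :=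
    (hH.isExtension hs₀).congr hHeq
  have hy : ‖(y : E3)‖ = 1 := by simp
  obtain ⟨c, R, hc, hcR⟩ := exists_pos_le_bulkL hm hs₀ hms₀ hp hup hL ⟨_, hHE⟩
  have hLlim := tendsto_bulkL (m := m) hs₀ hP y
  have hnorm : ∀ l : ℝ, 0 < l → ‖l • (y : E3)‖ = l := fun l hl => by
    rw [norm_smul, hy, mul_one, Real.norm_of_nonneg hl.le]
  have hLpos : 0 < nullL m P y 0 := by
    refine hc.trans_le (ge_of_tendsto hLlim ?_)
    filter_upwards [eventually_gt_atTop 0, eventually_ge_atTop R] with l hl hlR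
    exact hcR _ (by rwa [hnorm l hl])
  have hHlim := hHE.tendsto hs₀ hy
  have hyy : radialProj (y : E3) = y := by simpa using radialProj_smul y one_pos
  simp only [hyy] at hHlim
  obtain ⟨d, hd⟩ := tendsto_ray hs₀ (ExtendsToInfinity.sum fun i =>
    (hp.correction m hs₀ i).angDeriv hs₀ i) hy
  obtain ⟨k, hk⟩ := tendsto_ray hs₀ (((hp.bulkL m hs₀).scriDeriv hs₀).add
    (ExtendsToInfinity.sum fun i =>
      (hp.correction m hs₀ i).mul ((hp.bulkL m hs₀).angDeriv hs₀ i))) hy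
  have hinv := tendsto_inv_norm_ray hy
  have hlhs := (hHlim.const_mul 3).mul ((hLlim.sqrt).pow 3)
  have hrhs := (((hinv.mul hd).const_add 3).mul hLlim).sub ((hinv.mul hk).const_mul (1 / 2))
  -- the limit of the equation for `L` along the ray is `3 H₀ L^{3/2} = 3 L`
  have heq := tendsto_nhds_unique (hlhs.congr' (by
    filter_upwards [eventually_gt_atTop s₀⁻¹] with l hl
    have hx : s₀⁻¹ < ‖l • (y : E3)‖ := by rwa [hnorm l ((inv_pos.2 hs₀).trans hl)]
    exact graphMeanCurvature_mul hm hs₀ hms₀ hp hup hx (hL _ hx))) hrhs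
  have hH0 := hHpos y 0 ⟨le_rfl, hs₀⟩
  set q := √(nullL m P y 0) with hq
  have hq0 : 0 < q := Real.sqrt_pos.2 hLpos
  have hqq : q ^ 2 = nullL m P y 0 := Real.sq_sqrt hLpos.le
  rw [← hqq] at heq ⊢
  have h1 : H (y, 0) * q = 1 := by
    have h2 : q ^ 2 * (H (y, 0) * q - 1) = 0 := by linarith
    rcases mul_eq_zero.1 h2 with h3 | h3
    · exact absurd h3 (by positivity)
    · linarith
  rw [← inv_pow, eq_inv_of_mul_eq_one_right h1]
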